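/- **Setting.** Let $\gamma$ be holomorphic near $0\in\mathbb C$ with $\gamma(0)=0$, $\gamma'(0)=1$, and let $v\ge 0$ be real. Put $\sigma_s^v(\xi)=(\xi+v)^{-s}$ for $\xi\ge 1$ and regularise symbols (functions of $\xi$) by $\tau(z)(\xi)=\tau(\xi)(\xi+v)^{-\gamma(z)}$; write $\tilde{\mathcal R}_v(f_1\otimes\cdots\otimes f_k)(z)=f_1(z)\otimes\cdots\otimes f_k(z)$. For a composition $I=(i_1,\dots,i_r)$ of $k$ let $I[f_1\otimes\cdots\otimes f_k]=(f_1\cdots f_{i_1})\otimes(f_{i_1+1}\cdots f_{i_1+i_2})\otimes\cdots$ (pointwise products) and set, for $u=f_1\otimes\cdots\otimes f_k$, $$\exp u=\sum_{I}\frac{1}{i_1!\cdots i_r!}I[u],\qquad \log u=\sum_{I}\frac{(-1)^{k-r}}{i_1\cdots i_r}I[u],\qquad \tilde{\mathcal R}^\star_v=\exp\circ\tilde{\mathcal R}_v\circ\log .$$ The cut-off nested sum of $f_1\otimes\cdots\otimes f_k$ is the finite part, as $N\to\infty$, of $\sum_{0<n_k<\cdots<n_1\le N}f_1(n_1)\cdots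 f_k(n_k)$, that is, the constant term of its asymptotic expansion in terms $N^\alpha\log^l N$; it is extended linearly and equals $1$ on the empty tensor. Let $\Psi(u)(z)$ be the cut-off nested sum of $\tilde{\mathcal R}^\star_v(u)(z)$, for $z\ne 0$ near $0$. When these functions are meromorphic at $0$, let $\pi$ be the projection onto the pole part at $z=0$ and define recursively $$\Psi_-(u)=-\pi\Big[\Psi(u)+\sum\Psi_-(u')\Psi(u'')\Big],\qquad \Psi_+(u)=(1-\pi)\Big[\Psi(u)+\sum\Psi_-(u')\Psi(u'')\Big],$$ the sums being over all splittings $u=u'\otimes u''$ into two nonempty tensors. The renormalised Hurwitz multiple zeta value is $\zeta(s_1,\dots,s_k;v)=\Psi_+(\sigma_{s_1}^v\otimes\cdots\otimes\sigma_{s_k}^v)(0)$, with value $1$ for $k=0$. **Theorem.** For every such $\gamma$, every $k\ge 0$, all integers $a_1,\dots,a_k\ge 0$ and every real $v\ge 0$, the value $\zeta(-a_1,\dots,-a_k;v)$ is well defined (the cut-off nested sums exist for small $z\neq0$ and $\Psi(\sigma_{-a_1}^v\otimes\cdots\otimes\sigma_{-a_k}^v)$ is meromorphic at $0$). For $k\ge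 1$, $$\zeta(-a_1,\dots,-a_k;v+1)=\zeta(-a_1,\dots,-a_k;v)-(v+1)^{a_k}\,\zeta(-a_1,\dots,-a_{k-1};v+1).$$ If moreover $a_1,\dots,a_k\ge 1$, then for every $v\ge 0$ (one-sided derivative at $v=0$) $$\frac{d}{dv}\zeta(-a_1,\dots,-a_k;v)=\sum_{j=1}^k a_j\,\zeta(-a_1,\dots,-a_{j-1},-a_j+1,-a_{j+1},\dots,-a_k;v).$$ -/

import Mathlib

open Filter Topology Set

noncomputable section

namespace RenZeta

/-- `u N = c + ∑ aᵢ N ^ αᵢ (log N) ^ lᵢ + o(1)` as `N → ∞`, a finite sum over pairs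
`(αᵢ, lᵢ) ≠ (0, 0)` with `αᵢ` complex and `lᵢ` a natural number: `c` is the finite part
(constant term of the log-polyhomogeneous asymptotic expansion) of `u` at infinity. -/
def IsFinitePart (u : ℕ → ℂ) (c : ℂ) : Prop :=
  ∃ e : (ℂ × ℕ) →₀ ℂ, e (0, 0) = c ∧
    Tendsto (fun N : ℕ =>
        u N - e.sum (fun p a => a * (N : ℂ) ^ p.1 * ((Real.log N : ℝ) : ℂ) ^ p.2))
      atTop (𝓝 0)

open Classical in
/-- The finite part of `u` at infinity (`0` if there is none). -/
def finitePart (u : ℕ → ℂ) : ℂ :=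
  if h : ∃ c, IsFinitePart u c then h.choose else 0

/-- A word `[f₁, …, f_k]` stands for the elementary tensor `f₁ ⊗ ⋯ ⊗ f_k` of symbols. -/
abbrev Word := List (ℝ → ℂ)

/-- Formal linear combinations of words. All operations below are multilinear in the letters
and so come from the tensor algebra over the space of symbols. -/
abbrev Tens := Word →₀ ℂ

/-- The truncated nested sum `∑_{0 < n_k < ⋯ < n₁ < M} f₁(n₁) ⋯ f_k(n_k)`
(it is `1` for the empty word). -/
def nestedSum : Word → ℕ → ℂ
  | [], _ => 1
  | f :: w, M => ∑ n ∈ Finset.Ico 1 M, f n * nestedSum w n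

/-- `c` is the finite part, as `N → ∞`, of `∑_{0 < n_k < ⋯ < n₁ ≤ N} f₁(n₁) ⋯ f_k(n_k)`. -/
def IsCutoffSum (w : Word) (c : ℂ) : Prop :=
  IsFinitePart (fun N => nestedSum w (N + 1)) c

/-- The cut-off nested sum (strict version) of a word. -/
def cutoffSum (w : Word) : ℂ :=
  finitePart (fun N => nestedSum w (N + 1))

/-- The cut-off nested sum, extended linearly. -/
def cutoffSumLin : Tens →ₗ[ℂ] ℂ :=
  Finsupp.linearCombination ℂ cutoffSum

/-- For a composition `I = (i₁, …, i_r)` of `k`, the word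
`I[f₁ ⊗ ⋯ ⊗ f_k] = (f₁ ⋯ f_{i₁}) ⊗ (f_{i₁+1} ⋯ f_{i₁+i₂}) ⊗ ⋯` (pointwise products). -/
def contract (w : Word) (I : Composition w.length) : Word :=
  (w.splitWrtComposition I).map List.prod

/-- Hoffman's exponential. -/
def hoffmanExp : Tens →ₗ[ℂ] Tens :=
  Finsupp.linearCombination ℂ fun w : Word =>
    ∑ I : Composition w.length,
      Finsupp.single (contract w I) (((I.blocks.map Nat.factorial).prod : ℂ)⁻¹)

/-- Hoffman's logarithm. -/
def hoffmanLog : Tens →ₗ[ℂ] Tens :=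
  Finsupp.linearCombination ℂ fun w : Word =>
    ∑ I : Composition w.length,
      Finsupp.single (contract w I)
        ((-1 : ℂ) ^ (w.length - I.length) * ((I.blocks.prod : ℕ) : ℂ)⁻¹)

/-- The regularisation `τ ↦ τ(z)`, `τ(z)(ξ) = τ(ξ) (ξ + v) ^ (-γ(z))`, of a symbol. -/
def regularise (γ : ℂ → ℂ) (v : ℝ) (z : ℂ) (τ : ℝ → ℂ) : ℝ → ℂ :=
  fun ξ => τ ξ * ((ξ + v : ℝ) : ℂ) ^ (-γ z)

/-- `f₁ ⊗ ⋯ ⊗ f_k ↦ f₁(z) ⊗ ⋯ ⊗ f_k(z)`. -/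
def regTensor (γ : ℂ → ℂ) (v : ℝ) (z : ℂ) : Tens →ₗ[ℂ] Tens :=
  Finsupp.linearCombination ℂ fun w : Word =>
    Finsupp.single (w.map (regularise γ v z)) 1

/-- The regularisation compatible with the stuffle product: `exp ∘ (regularise) ∘ log`. -/
def regStuffle (γ : ℂ → ℂ) (v : ℝ) (z : ℂ) : Tens →ₗ[ℂ] Tens :=
  hoffmanExp ∘ₗ regTensor γ v z ∘ₗ hoffmanLog

/-- The map `w ↦ (z ↦ cut-off nested sum of the stuffle-regularised word)`. -/
def regSum (γ : ℂ → ℂ) (v : ℝ) (w : Word) (z : ℂ) : ℂ :=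
  cutoffSumLin (regStuffle γ v z (Finsupp.single w 1))

/-- `f(z) = p(1/z) + g(z)` near `0`, with `p` without constant term and `g` holomorphic. -/
def IsPolePart (f : ℂ → ℂ) (p : Polynomial ℂ) : Prop :=
  p.coeff 0 = 0 ∧ ∃ g : ℂ → ℂ, AnalyticAt ℂ g 0 ∧ ∀ᶠ z in 𝓝[≠] (0 : ℂ), f z = p.eval z⁻¹ + g z

open Classical in
/-- The pole part of `f` at `0`, a polynomial in `1/z` without constant term
(`0` if `f` is not meromorphic at `0`). -/
def polePart (f : ℂ → ℂ) : Polynomial ℂ :=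
  if h : ∃ p, IsPolePart f p then h.choose else 0

/-- The counterterm `Φ₋` of the Birkhoff decomposition, with respect to deconcatenation and
minimal subtraction, as a polynomial in `1/z`:
`Φ₋(w) = -π[Φ(w) + ∑ Φ₋(w') Φ(w'')]`, the sum over `w = w' w''` with both factors nonempty. -/
def birkhoffMinus (Φ : Word → ℂ → ℂ) (w : Word) : Polynomial ℂ :=
  if w = [] then 1 else
    -polePart (fun z => Φ w z + ∑ j : Fin (w.length - 1),
      (birkhoffMinus Φ (w.take (j + 1))).eval z⁻¹ * Φ (w.drop (j + 1)) z)
termination_by w.length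
decreasing_by
  have := j.2
  simp only [List.length_take]
  omega

/-- `Φ(w) + ∑ Φ₋(w') Φ(w'')`, the sum over `w = w' w''` with both factors nonempty. -/
def birkhoffPrepared (Φ : Word → ℂ → ℂ) (w : Word) (z : ℂ) : ℂ :=
  Φ w z + ∑ j : Fin (w.length - 1),
    (birkhoffMinus Φ (w.take (j + 1))).eval z⁻¹ * Φ (w.drop (j + 1)) z

/-- The renormalised part `Φ₊ = (1 - π)[Φ(w) + ∑ Φ₋(w') Φ(w'')]`. -/
def birkhoffPlus (Φ : Word → ℂ → ℂ) (w : Word) (z : ℂ) : ℂ :=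
  birkhoffPrepared Φ w z - (polePart (birkhoffPrepared Φ w)).eval z⁻¹

/-- The renormalised nested sum of a word: the value at `z = 0` of the holomorphic extension
of `Φ₊`, where `Φ` is `regSum`. -/
def renSum (γ : ℂ → ℂ) (v : ℝ) (w : Word) : ℂ :=
  limUnder (𝓝[≠] (0 : ℂ)) (birkhoffPlus (regSum γ v) w)

/-- The symbol `ξ ↦ (ξ + v) ^ (-s)`; only its values for `ξ ≥ 1` matter. -/
def symb (v : ℝ) (s : ℂ) : ℝ → ℂ :=
  fun ξ => ((ξ + v : ℝ) : ℂ) ^ (-s)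

/-- The word `σ_{s₁}^v ⊗ ⋯ ⊗ σ_{s_k}^v`. -/
def symbWord {k : ℕ} (s : Fin k → ℂ) (v : ℝ) : Word :=
  List.ofFn fun i => symb v (s i)

/-- The renormalised Hurwitz multiple zeta value `ζ(s₁, …, s_k; v)`. -/
def zeta (γ : ℂ → ℂ) {k : ℕ} (s : Fin k → ℂ) (v : ℝ) : ℂ :=
  renSum γ v (symbWord s v)

/-- The renormalisation of `w` makes sense: near `z = 0`, `z ≠ 0`, every cut-off nested sum
that enters `regSum γ v w z` exists, and `regSum γ v w` is meromorphic at `0`. -/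
def IsRenormalisable (γ : ℂ → ℂ) (v : ℝ) (w : Word) : Prop :=
  (∀ᶠ z in 𝓝[≠] (0 : ℂ), ∀ u ∈ (regStuffle γ v z (Finsupp.single w 1)).support,
      ∃ c, IsCutoffSum u c) ∧
    MeromorphicAt (regSum γ v w) 0

end RenZeta

end

noncomputable section

namespace RenZeta

/-! At nonpositive integers nothing has to be renormalised: the regularised sums extend
holomorphically to `z = 0`, all counterterms of nonempty words vanish, and the renormalised value is
the value of the extension at `0`. Both identities then come from identities between finite sums.

Holomorphy. Put `g = γ z`. After `exp` and `log`, the letters are `(n + v) ^ (A - r g)` with `A ≥ 0`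
and `r ≥ 1`. Expanding in powers of `n` gives terms `n ^ (q - R g)`, and each term with `q < 0`
carries a factor `g`, since a falling factorial of `A - r g` of order greater than `A` vanishes at
`g = 0`. Products preserve this shape. Summation over `n` divides by `q + 1 - R g`, which vanishes
at `g = 0` only for `q = -1`, and there the factor `g` cancels the pole (`exists_polePre_div`). So
nested sums have, by induction on depth, expansions whose coefficients are holomorphic in `g` and
continuous in `(g, v)`, plus a constant `C (g, v)` of the same kind
(`exists_letterSum_and_mul_expansion`). For small `g ≠ 0` no exponent `q - R g` with `R ≥ 1` is
zero, so the finite part is exactly `C` (`exists_isFamily`).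

Shift. Separating the terms whose smallest index is `1` writes the sum at `v` as a deconcatenation
convolution of the sum at `v + 1` with a functional supported on lists of length at most one
(`letterSum_succ_eq_conv`). Contraction sums are multiplicative for this convolution, and that
functional is restored by `exp` followed by `log` because `exp (log (1 + X)) = 1 + X`
(`twisted_append`).

Derivative. Differentiation in `v` lowers one exponent at a time. Lowering acts as a derivation on
merged letters, hence commutes with contractions (`lowerSum_twisted`). It is passed through finite
parts in integrated form, where only the coefficients of the expansion depend on `v`
(`renLetter_sub_eq_integral`). The exponents must be at least `1` for the lowered letters to stay in
the class. -/

/-! ### Uniqueness and linearity of the finite part. -/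

theorem exists_natCast_cpow_ne_one {β : ℂ} (hβ : β ≠ 0) : ∃ p : ℕ, 1 ≤ p ∧ (p : ℂ) ^ β ≠ 1 := by
  by_contra! H
  -- If both `p ^ β` and `(p + 1) ^ β` were `1`, then `β (log (p + 1) - log p)` would be a multiple
  -- of `2πi`; it is nonzero, and `p > ‖β‖` makes its norm smaller than `1`.
  obtain ⟨p, hp⟩ := exists_nat_gt ‖β‖
  have hp0 : (0 : ℝ) < p := lt_of_le_of_lt (norm_nonneg _) hp
  have hp1 : 1 ≤ p := by exact_mod_cast hp0
  have h1 := H p hp1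
  have h2 := H (p + 1) (by omega)
  rw [Complex.cpow_def_of_ne_zero (by exact_mod_cast hp0.ne')] at h1
  rw [Complex.cpow_def_of_ne_zero (by exact_mod_cast p.succ_ne_zero)] at h2
  have h3 : Complex.exp (((Real.log (p + 1) - Real.log p : ℝ) : ℂ) * β) = 1 := by
    have e1 : Complex.log ((p + 1 : ℕ) : ℂ) = ((Real.log (p + 1) : ℝ) : ℂ) := by
      rw [Complex.ofReal_log (by positivity)]; push_cast; rfl
    have e2 : Complex.log (p : ℂ) = ((Real.log p : ℝ) : ℂ) := by
      rw [Complex.ofReal_log (by positivity)]; push_cast; rfl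
    rw [Complex.ofReal_sub, sub_mul, Complex.exp_sub, ← e1, ← e2, h1, h2, div_one]
  obtain ⟨n, hn⟩ := Complex.exp_eq_one_iff.1 h3
  have hlog : Real.log (p + 1) - Real.log p ≤ 1 / p := by
    rw [← Real.log_div (by positivity) (by positivity)]
    have := Real.log_le_sub_one_of_pos (x := (p + 1 : ℝ) / p) (by positivity)
    refine this.trans (le_of_eq ?_)
    field_simp
    ring
  have hlog0 : 0 < Real.log (p + 1) - Real.log p := by
    have := Real.log_lt_log hp0 (lt_add_one (p : ℝ))
    linarith
  have hn0 : n ≠ 0 := by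
    rintro rfl
    simp only [Int.cast_zero, zero_mul, mul_eq_zero, Complex.ofReal_eq_zero] at hn
    rcases hn with hn | hn
    · exact hlog0.ne' hn
    · exact hβ hn
  have hnorm := congrArg norm hn
  rw [norm_mul, norm_mul, Complex.norm_real, Real.norm_of_nonneg hlog0.le] at hnorm
  have h4 : ‖(n : ℂ)‖ ≥ 1 := by
    rw [Complex.norm_intCast]
    exact_mod_cast Int.one_le_abs hn0
  have h5 : ‖(2 * Real.pi * Complex.I : ℂ)‖ = 2 * Real.pi := by
    simp [abs_of_pos Real.pi_pos]
  rw [h5] at hnorm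
  have h6 : (Real.log (p + 1) - Real.log p) * ‖β‖ < 1 := by
    calc (Real.log (p + 1) - Real.log p) * ‖β‖ ≤ 1 / p * ‖β‖ := by gcongr
      _ < 1 := by rw [one_div_mul_eq_div, div_lt_one hp0]; exact hp
  nlinarith [Real.pi_gt_three]

open Polynomial in
/-- A finite sum `∑ N ^ β P_β(log N)` with `β` ranging over `s`. -/
def logPoly (s : Finset ℂ) (P : ℂ → ℂ[X]) (N : ℕ) : ℂ :=
  ∑ β ∈ s, (N : ℂ) ^ β * (P β).eval ((Real.log N : ℝ) : ℂ)

open Polynomial in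
theorem logPoly_mul (s : Finset ℂ) (P : ℂ → ℂ[X]) {p N : ℕ} (hp : 1 ≤ p) (hN : 1 ≤ N) (b : ℂ) :
    logPoly s P (p * N) - b * logPoly s P N =
      logPoly s (fun β => C ((p : ℂ) ^ β) * taylor ((Real.log p : ℝ) : ℂ) (P β) - C b * P β) N := by
  unfold logPoly
  rw [Finset.mul_sum, ← Finset.sum_sub_distrib]
  refine Finset.sum_congr rfl fun β _ => ?_
  have h1 : ((p * N : ℕ) : ℂ) ^ β = (p : ℂ) ^ β * (N : ℂ) ^ β := by
    rw [Nat.cast_mul, Complex.natCast_mul_natCast_cpow]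
  have h2 : Real.log ((p * N : ℕ) : ℝ) = Real.log N + Real.log p := by
    rw [Nat.cast_mul, Real.log_mul (by positivity) (by positivity), add_comm]
  rw [h1, h2]
  simp only [eval_sub, eval_mul, eval_C, taylor_eval, Complex.ofReal_add]
  ring

open Polynomial in
-- Induction on the set of exponents, then on the degree of one `P β`. Replacing `u N` by `u (p N) -
-- p ^ β u N` lowers the degree of `P β`, while the leading coefficient of `Q` is multiplied by `1 -
-- p ^ β`, nonzero for a suitable `p`; so no nonzero `Q` can be cancelled by the other terms.
theorem eq_zero_of_tendsto_logPoly (s : Finset ℂ) : (0 : ℂ) ∉ s → ∀ (P : ℂ → ℂ[X]) (Q : ℂ[X]),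
    Tendsto (fun N : ℕ => logPoly s P N + Q.eval ((Real.log N : ℝ) : ℂ)) atTop (𝓝 0) → Q = 0 := by
  classical
  induction s using Finset.induction_on with
  | empty =>
    intro _ P Q h
    simp only [logPoly, Finset.sum_empty, zero_add] at h
    by_contra hQ
    by_cases hd : 0 < Q.degree
    · have hlog : Tendsto (fun N : ℕ => ‖((Real.log N : ℝ) : ℂ)‖) atTop atTop := by
        simp only [Complex.norm_real]
        exact tendsto_norm_atTop_atTop.comp
          (Real.tendsto_log_atTop.comp tendsto_natCast_atTop_atTop)
      have h1 := Q.tendsto_norm_atTop hd hlog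
      have h2 := h.norm
      rw [norm_zero] at h2
      exact not_tendsto_nhds_of_tendsto_atTop h1 _ h2
    · have h0 : Q = C (Q.coeff 0) := eq_C_of_degree_le_zero (not_lt.1 hd)
      rw [h0] at h
      simp only [eval_C] at h
      have := tendsto_nhds_unique h tendsto_const_nhds
      rw [← this, C_0] at h0
      exact hQ h0
  | insert β s hβs ih =>
    intro h0 P Q h
    have hβ : β ≠ 0 := fun h => h0 (h ▸ Finset.mem_insert_self _ _)
    have h0s : (0 : ℂ) ∉ s := fun h => h0 (Finset.mem_insert_of_mem h)
    obtain ⟨p, hp1, hp⟩ := exists_natCast_cpow_ne_one hβ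
    suffices H : ∀ (d : ℕ) (P : ℂ → ℂ[X]) (Q : ℂ[X]), (P β).degree < d →
        Tendsto (fun N : ℕ => logPoly (insert β s) P N + Q.eval ((Real.log N : ℝ) : ℂ))
          atTop (𝓝 0) → Q = 0 from
      H ((P β).natDegree + 1) P Q
        (lt_of_le_of_lt degree_le_natDegree (by exact_mod_cast Nat.lt_succ_self _)) h
    clear h P Q
    intro d
    induction d with
    | zero =>
      intro P Q hd h
      have hP : P β = 0 := by
        rw [← degree_eq_bot]
        exact Nat.WithBot.lt_zero_iff.1 (by simpa using hd)
      refine ih h0s P Q ?_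
      simpa [logPoly, Finset.sum_insert hβs, hP] using h
    | succ d ihd =>
      intro P Q hd h
      set t : ℂ := ((Real.log p : ℝ) : ℂ) with ht
      have hcomb : Tendsto (fun N : ℕ =>
          logPoly (insert β s) (fun α => C ((p : ℂ) ^ α) * taylor t (P α)
            - C ((p : ℂ) ^ β) * P α) N
          + (taylor t Q - C ((p : ℂ) ^ β) * Q).eval ((Real.log N : ℝ) : ℂ)) atTop (𝓝 0) := by
        have hmul : Tendsto (fun N : ℕ => p * N) atTop atTop :=
          tendsto_id.const_mul_atTop' hp1
        have h1 := (h.comp hmul).sub (h.const_mul ((p : ℂ) ^ β))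
        rw [mul_zero, sub_zero] at h1
        refine h1.congr' ?_
        filter_upwards [eventually_ge_atTop 1] with N hN
        rw [← logPoly_mul _ _ hp1 hN]
        have h2 : Real.log ((p * N : ℕ) : ℝ) = Real.log N + Real.log p := by
          rw [Nat.cast_mul, Real.log_mul (by positivity) (by positivity), add_comm]
        simp only [Function.comp, eval_sub, eval_mul, eval_C, taylor_eval, h2, ht, Complex.ofReal_add]
        ring
      have hQ := ihd _ _ ?_ hcomb
      · by_contra hQ0
        have h3 := congrArg leadingCoeff (sub_eq_zero.1 hQ)
        rw [leadingCoeff_taylor, leadingCoeff_mul, leadingCoeff_C] at h3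
        have h4 : Q.leadingCoeff ≠ 0 := leadingCoeff_ne_zero.2 hQ0
        refine hp (mul_right_cancel₀ h4 ?_)
        rw [← h3, one_mul]
      · rw [← mul_sub]
        by_cases hP : P β = 0
        · simp [hP]
        have h5 : (taylor t (P β) - P β).degree < (P β).degree := by
          have := degree_sub_lt_left (p := taylor t (P β)) (q := P β) (degree_taylor _ _)
            (by simpa using hP) (by rw [leadingCoeff_taylor])
          rwa [degree_taylor] at this
        have hpβ : (p : ℂ) ^ β ≠ 0 := by
          intro h
          have := ((Complex.cpow_eq_zero_iff _ _).1 h).1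
          norm_cast at this
          omega
        rw [degree_C_mul hpβ]
        refine lt_of_lt_of_le h5 (degree_le_of_natDegree_le (Nat.lt_succ_iff.1 ?_))
        exact (natDegree_lt_iff_degree_lt hP).2 hd

theorem IsFinitePart.unique_zero {c : ℂ} (h : IsFinitePart (fun _ => 0) c) : c = 0 := by
  classical
  obtain ⟨e, rfl, h⟩ := h
  let P : ℂ → Polynomial ℂ := fun β =>
    ∑ p ∈ e.support with p.1 = β, Polynomial.monomial p.2 (e p)
  let t := insert 0 (e.support.image Prod.fst)
  have key : ∀ N : ℕ, e.sum (fun p a => a * (N : ℂ) ^ p.1 * ((Real.log N : ℝ) : ℂ) ^ p.2) =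
      logPoly (t.erase 0) P N + (P 0).eval ((Real.log N : ℝ) : ℂ) := by
    intro N
    have h1 : logPoly t P N =
        e.sum (fun p a => a * (N : ℂ) ^ p.1 * ((Real.log N : ℝ) : ℂ) ^ p.2) := by
      rw [Finsupp.sum, ← Finset.sum_fiberwise_of_maps_to (s := e.support) (t := t) (g := Prod.fst)
        (fun p hp => Finset.mem_insert_of_mem (Finset.mem_image_of_mem _ hp))]
      refine Finset.sum_congr rfl fun β _ => ?_
      simp only [P, Polynomial.eval_finsetSum, Polynomial.eval_monomial, Finset.mul_sum]
      refine Finset.sum_congr rfl fun p hp => ?_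
      rw [(Finset.mem_filter.1 hp).2]
      ring
    rw [← h1, logPoly, logPoly, ← Finset.sum_erase_add t _ (Finset.mem_insert_self 0 _)]
    simp
  have h2 := eq_zero_of_tendsto_logPoly (t.erase 0) (Finset.notMem_erase _ _) P (P 0) (by
    have := h.neg
    simp only [zero_sub, neg_neg, neg_zero] at this
    exact this.congr key)
  have h3 : (P 0).coeff 0 = e (0, 0) := by
    simp only [P, Polynomial.finsetSum_coeff, Polynomial.coeff_monomial]
    rw [Finset.sum_filter]
    rw [Finset.sum_eq_single ((0 : ℂ), 0)]
    · simp
    · rintro ⟨a, b⟩ _ hb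
      by_cases ha : a = 0 <;> by_cases hb' : b = 0 <;> simp_all
    · intro h
      simpa using h
  rw [← h3, h2, Polynomial.coeff_zero]

theorem IsFinitePart.add {u w : ℕ → ℂ} {c d : ℂ} (hu : IsFinitePart u c) (hw : IsFinitePart w d) :
    IsFinitePart (fun N => u N + w N) (c + d) := by
  classical
  obtain ⟨e, rfl, he⟩ := hu
  obtain ⟨f, rfl, hf⟩ := hw
  refine ⟨e + f, rfl, ?_⟩
  have := he.add hf
  rw [add_zero] at this
  refine this.congr fun N => ?_
  rw [Finsupp.sum_add_index' (by simp) (by intros; ring)]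
  ring

theorem IsFinitePart.const_mul {u : ℕ → ℂ} {c : ℂ} (hu : IsFinitePart u c) (a : ℂ) :
    IsFinitePart (fun N => a * u N) (a * c) := by
  obtain ⟨e, rfl, he⟩ := hu
  refine ⟨a • e, rfl, ?_⟩
  have := he.const_mul a
  rw [mul_zero] at this
  refine this.congr fun N => ?_
  rw [Finsupp.sum_smul_index (by simp), mul_sub, Finsupp.mul_sum]
  simp only [mul_assoc]

theorem IsFinitePart.sub {u w : ℕ → ℂ} {c d : ℂ} (hu : IsFinitePart u c) (hw : IsFinitePart w d) :
    IsFinitePart (fun N => u N - w N) (c - d) := by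
  simpa [sub_eq_add_neg] using hu.add (hw.const_mul (-1))

theorem IsFinitePart.congr {u w : ℕ → ℂ} {c : ℂ} (hu : IsFinitePart u c)
    (h : ∀ᶠ N in atTop, u N = w N) : IsFinitePart w c := by
  obtain ⟨e, rfl, he⟩ := hu
  refine ⟨e, rfl, he.congr' ?_⟩
  filter_upwards [h] with N hN
  rw [hN]

theorem IsFinitePart.unique {u : ℕ → ℂ} {c d : ℂ} (hu : IsFinitePart u c)
    (hw : IsFinitePart u d) : c = d := by
  have := hu.sub hw
  simp only [sub_self] at this
  exact sub_eq_zero.1 this.unique_zero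

theorem IsFinitePart.finitePart_eq {u : ℕ → ℂ} {c : ℂ} (hu : IsFinitePart u c) :
    finitePart u = c := by
  have h : ∃ c, IsFinitePart u c := ⟨c, hu⟩
  rw [finitePart, dif_pos h]
  exact h.choose_spec.unique hu

theorem isFinitePart_of_tendsto {u : ℕ → ℂ} {c : ℂ} (hu : Tendsto u atTop (𝓝 c)) :
    IsFinitePart u c := by
  refine ⟨Finsupp.single (0, 0) c, by simp, ?_⟩
  have := hu.sub_const c
  rw [sub_self] at this
  refine this.congr fun N => ?_
  rw [Finsupp.sum_single_index (by simp)]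
  simp

theorem isFinitePart_cpow {α : ℂ} (hα : α ≠ 0) : IsFinitePart (fun N => (N : ℂ) ^ α) 0 := by
  classical
  refine ⟨Finsupp.single (α, 0) 1, ?_, ?_⟩
  · rw [Finsupp.single_apply, if_neg (by simpa using hα)]
  · refine tendsto_const_nhds.congr fun N => ?_
    rw [Finsupp.sum_single_index (by simp)]
    simp

theorem isFinitePart_sum {ι : Type*} (s : Finset ι) {u : ι → ℕ → ℂ} {c : ι → ℂ}
    (h : ∀ i ∈ s, IsFinitePart (u i) (c i)) :
    IsFinitePart (fun N => ∑ i ∈ s, u i N) (∑ i ∈ s, c i) := by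
  classical
  induction s using Finset.induction_on with
  | empty => simpa using isFinitePart_of_tendsto (tendsto_const_nhds (x := (0 : ℂ)))
  | insert i s hi ih =>
    simp only [Finset.sum_insert hi]
    exact (h i (Finset.mem_insert_self _ _)).add
      (ih fun j hj => h j (Finset.mem_insert_of_mem hj))

/-! ### Contractions of lists: from compositions to recursion, and the lowering of letters. -/

section ContractionSums

variable {Λ Λ' E E' : Type*} [AddCommGroup E] [Module ℂ E] [AddCommGroup E'] [Module ℂ E']

/-- The contractions of `s :: l` whose first block has the `m` letters merged in `s` and possibly
more, a block of `i` letters being weighted with `c i`. -/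
def blockSum (op : Λ → Λ → Λ) (c : ℕ → ℂ) : ℕ → Λ → List Λ → (List Λ → E) → E
  | m, s, [], F => c m • F [s]
  | m, s, y :: l, F =>
    c m • blockSum op c 1 y l (fun l' => F (s :: l')) + blockSum op c (m + 1) (op s y) l F

/-- The sum over all contractions of a list, a block of `i` letters being weighted with `c i`. -/
def contractSum (op : Λ → Λ → Λ) (c : ℕ → ℂ) (F : List Λ → E) : List Λ → E
  | [] => F []
  | x :: l => blockSum op c 1 x l F

/-- The composition of `n + 1` with first block `1`. -/
def consOne {n : ℕ} (I : Composition n) : Composition (n + 1) where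
  blocks := 1 :: I.blocks
  blocks_pos := by
    intro i hi
    rcases List.mem_cons.1 hi with rfl | hi
    · exact one_pos
    · exact I.blocks_pos hi
  blocks_sum := by simp [add_comm]

/-- The composition of `n + 2` obtained by enlarging the first block of a composition. -/
def growHead {n : ℕ} (I : Composition (n + 1)) : Composition (n + 2) where
  blocks := (I.blocks.headI + 1) :: I.blocks.tail
  blocks_pos := by
    intro i hi
    rcases List.mem_cons.1 hi with rfl | hi
    · omega
    · exact I.blocks_pos (List.mem_of_mem_tail hi)
  blocks_sum := by
    have h := I.blocks_sum
    rcases hb : I.blocks with _ | ⟨a, t⟩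
    · simp [hb] at h
    · rw [hb] at h
      simp only [List.sum_cons, List.headI_cons, List.tail_cons] at h ⊢
      omega

/-- A first block is either equal to `1`, and can be removed, or larger, and can be shrunk by one.
These two cases are the two terms of the recursion for `blockSum`. -/
theorem sum_composition_succ_succ {G : Type*} [AddCommMonoid G] {n : ℕ} (φ : List ℕ → G) :
    ∑ I : Composition (n + 2), φ I.blocks =
      ∑ I : Composition (n + 1), φ (1 :: I.blocks) +
        ∑ I : Composition (n + 1), φ ((I.blocks.headI + 1) :: I.blocks.tail) := by
  have h := Fintype.sum_sum_type (fun x : Composition (n + 1) ⊕ Composition (n + 1) =>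
    φ (Sum.elim consOne growHead x).blocks)
  refine Eq.trans ?_ h
  symm
  refine Fintype.sum_bijective (Sum.elim consOne growHead) ⟨?_, ?_⟩ _ _ ?_
  · rintro (I | I) (J | J) h <;> have hb := congrArg Composition.blocks h
    · simp only [Sum.elim_inl, consOne, List.cons.injEq, true_and] at hb
      rw [Composition.ext hb]
    · simp only [Sum.elim_inl, Sum.elim_inr, consOne, growHead, List.cons.injEq] at hb
      have h := J.blocks_sum
      rcases hJ : J.blocks with _ | ⟨a, t⟩
      · simp [hJ] at h
      · have := J.blocks_pos (i := a) (by simp [hJ])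
        simp only [hJ, List.headI_cons] at hb
        omega
    · simp only [Sum.elim_inl, Sum.elim_inr, consOne, growHead, List.cons.injEq] at hb
      have h := I.blocks_sum
      rcases hI : I.blocks with _ | ⟨a, t⟩
      · simp [hI] at h
      · have := I.blocks_pos (i := a) (by simp [hI])
        simp only [hI, List.headI_cons] at hb
        omega
    · simp only [Sum.elim_inr, growHead, List.cons.injEq, Nat.add_right_cancel_iff] at hb
      have h1 := I.blocks_sum
      have h2 := J.blocks_sum
      congr 1
      apply Composition.ext
      rcases hI : I.blocks with _ | ⟨a, t⟩
      · simp [hI] at h1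
      rcases hJ : J.blocks with _ | ⟨b, t'⟩
      · simp [hJ] at h2
      simpa [hI, hJ] using hb
  · intro J
    have h := J.blocks_sum
    rcases hJ : J.blocks with _ | ⟨a, t⟩
    · simp [hJ] at h
    have ha := J.blocks_pos (i := a) (by simp [hJ])
    have ht : ∀ {i}, i ∈ t → 0 < i := fun hi => J.blocks_pos (by simp [hJ, hi])
    rw [hJ, List.sum_cons] at h
    by_cases h1 : a = 1
    · refine ⟨Sum.inl ⟨t, ht, by omega⟩, Composition.ext ?_⟩
      simp [consOne, hJ, h1]
    · refine ⟨Sum.inr ⟨(a - 1) :: t, ?_, ?_⟩, Composition.ext ?_⟩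
      · intro i hi
        rcases List.mem_cons.1 hi with rfl | hi
        · omega
        · exact ht hi
      · rw [List.sum_cons]
        omega
      · simp only [Sum.elim_inr, growHead, List.headI_cons, List.tail_cons, hJ]
        congr 1
        omega
  · intro I; rfl

theorem blocks_eq_singleton (I : Composition 1) : I.blocks = [1] := by
  have h := I.blocks_sum
  rcases hI : I.blocks with _ | ⟨a, t⟩
  · simp [hI] at h
  have ha := I.blocks_pos (i := a) (by simp [hI])
  rw [hI, List.sum_cons] at h
  rcases t with _ | ⟨b, t⟩
  · simp only [List.sum_nil] at h
    rw [show a = 1 by omega]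
  · have hb := I.blocks_pos (i := b) (by simp [hI])
    rw [List.sum_cons] at h
    omega

theorem sum_composition_one {G : Type*} [AddCommMonoid G] (φ : List ℕ → G) : ∑ I : Composition 1, φ I.blocks = φ [1] := by
  have : Fintype.card (Composition 1) = 1 := by simp [composition_card]
  rw [Finset.sum_congr rfl fun I _ => by rw [blocks_eq_singleton I]]
  simp [this]

/-- The head of the composition counts `s` as one letter; `m` counts the letters merged into `s`
beyond that one, whence the weight `c (head + m)`. -/
theorem sum_composition_succ_eq_blockSum [Monoid Λ] (c : ℕ → ℂ) (l : List Λ) :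
    ∀ (m : ℕ) (s : Λ) (F : List Λ → E),
    ∑ I : Composition (l.length + 1),
        (c (I.blocks.headI + m) * (I.blocks.tail.map c).prod) •
          F (s * (l.take (I.blocks.headI - 1)).prod ::
            ((l.drop (I.blocks.headI - 1)).splitWrtCompositionAux I.blocks.tail).map List.prod) =
      blockSum (· * ·) c (m + 1) s l F := by
  induction l with
  | nil =>
    intro m s F
    rw [List.length_nil, zero_add, sum_composition_one (fun b =>
      (c (b.headI + m) * (b.tail.map c).prod) •
        F (s * (List.take (b.headI - 1) []).prod ::
          ((List.drop (b.headI - 1) []).splitWrtCompositionAux b.tail).map List.prod))]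
    simp [blockSum, List.splitWrtCompositionAux, add_comm]
  | cons y l ih =>
    intro m s F
    rw [List.length_cons, sum_composition_succ_succ (fun b =>
      (c (b.headI + m) * (b.tail.map c).prod) •
        F (s * ((y :: l).take (b.headI - 1)).prod ::
          (((y :: l).drop (b.headI - 1)).splitWrtCompositionAux b.tail).map List.prod))]
    rw [blockSum, ← ih 0 y, ← ih (m + 1) (s * y), Finset.smul_sum]
    congr 1
    · refine Finset.sum_congr rfl fun I _ => ?_
      have h := I.blocks_sum
      rcases hI : I.blocks with _ | ⟨a, t⟩
      · simp [hI] at h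
      have ha := I.blocks_pos (i := a) (by simp [hI])
      obtain ⟨a, rfl⟩ : ∃ b, a = b + 1 := ⟨a - 1, by omega⟩
      simp [List.splitWrtCompositionAux_cons, smul_smul, add_comm]
    · refine Finset.sum_congr rfl fun I _ => ?_
      have h := I.blocks_sum
      rcases hI : I.blocks with _ | ⟨a, t⟩
      · simp [hI] at h
      have ha := I.blocks_pos (i := a) (by simp [hI])
      obtain ⟨a, rfl⟩ : ∃ b, a = b + 1 := ⟨a - 1, by omega⟩
      simp [add_assoc, add_comm, mul_assoc]

theorem sum_composition_eq_contractSum [Monoid Λ] (c : ℕ → ℂ) (F : List Λ → E) (l : List Λ) :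
    ∑ I : Composition l.length,
        (I.blocks.map c).prod • F ((l.splitWrtComposition I).map List.prod) =
      contractSum (· * ·) c F l := by
  cases l with
  | nil =>
    have : ∀ I : Composition 0, I.blocks = [] := fun I => by simp
    have hc : Fintype.card (Composition 0) = 1 := by simp [composition_card]
    rw [Finset.sum_congr rfl fun I _ => by
      rw [List.splitWrtComposition, show Composition.blocks I = [] from this I]]
    simp only [List.length_nil, List.splitWrtCompositionAux, List.map_nil, List.prod_nil, one_smul,
      Finset.sum_const, contractSum]
    rw [Finset.card_univ, hc, one_smul]
  | cons x l =>
    rw [contractSum, ← sum_composition_succ_eq_blockSum c l 0 x F, List.length_cons]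
    refine Finset.sum_congr rfl fun I _ => ?_
    have h := I.blocks_sum
    rw [List.splitWrtComposition]
    rcases hI : I.blocks with _ | ⟨a, t⟩
    · simp [hI] at h
    have ha := I.blocks_pos (i := a) (by simp [hI])
    obtain ⟨a, rfl⟩ : ∃ b, a = b + 1 := ⟨a - 1, by omega⟩
    simp [List.splitWrtCompositionAux_cons]

theorem blockSum_map {op : Λ → Λ → Λ} {op' : Λ' → Λ' → Λ'} {φ : Λ → Λ'}
    (hφ : ∀ x y, φ (op x y) = op' (φ x) (φ y)) (c : ℕ → ℂ) (l : List Λ) :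
    ∀ (m : ℕ) (s : Λ) (F : List Λ' → E),
    blockSum op' c m (φ s) (l.map φ) F = blockSum op c m s l (fun l => F (l.map φ)) := by
  induction l with
  | nil => intro m s F; rfl
  | cons y l ih =>
    intro m s F
    rw [List.map_cons, blockSum, blockSum, ← hφ, ih, ih]
    rfl

theorem contractSum_map {op : Λ → Λ → Λ} {op' : Λ' → Λ' → Λ'} {φ : Λ → Λ'}
    (hφ : ∀ x y, φ (op x y) = op' (φ x) (φ y)) (c : ℕ → ℂ) (F : List Λ' → E) (l : List Λ) :
    contractSum op' c F (l.map φ) = contractSum op c (fun l => F (l.map φ)) l := by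
  cases l with
  | nil => rfl
  | cons x l => exact blockSum_map hφ c l 1 x F

/-- Applied with a product module and its projections, this naturality also yields additivity in
`F`. -/
theorem map_blockSum (op : Λ → Λ → Λ) (c : ℕ → ℂ) (f : E →ₗ[ℂ] E') (l : List Λ) :
    ∀ (m : ℕ) (s : Λ) (F : List Λ → E),
    f (blockSum op c m s l F) = blockSum op c m s l (fun l => f (F l)) := by
  induction l with
  | nil => intro m s F; simp [blockSum]
  | cons y l ih => intro m s F; simp [blockSum, ih]

theorem map_contractSum (op : Λ → Λ → Λ) (c : ℕ → ℂ) (f : E →ₗ[ℂ] E') (F : List Λ → E)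
    (l : List Λ) : f (contractSum op c F l) = contractSum op c (fun l => f (F l)) l := by
  cases l with
  | nil => rfl
  | cons x l => exact map_blockSum op c f l 1 x F

theorem blockSum_mem {op : Λ → Λ → Λ} {p : Λ → Prop} (hp : ∀ x y, p x → p y → p (op x y))
    (c : ℕ → ℂ) (S : Submodule ℂ E) (l : List Λ) (hl : ∀ x ∈ l, p x) :
    ∀ (m : ℕ) (s : Λ) (F : List Λ → E), p s → (∀ l, (∀ x ∈ l, p x) → F l ∈ S) →
    blockSum op c m s l F ∈ S := by
  induction l with
  | nil =>
    intro m s F hs hF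
    exact S.smul_mem _ (hF _ (by simpa using hs))
  | cons y l ih =>
    intro m s F hs hF
    rw [List.forall_mem_cons] at hl
    exact S.add_mem (S.smul_mem _ (ih hl.2 _ _ _ hl.1 fun l hl => hF _ (by
      rw [List.forall_mem_cons]; exact ⟨hs, hl⟩)))
      (ih hl.2 _ _ _ (hp _ _ hs hl.1) hF)

/-- Contraction sums stay in a submodule. With `E` a product or a space of functions this
transports relations that are compatible with linear combinations. -/
theorem contractSum_mem {op : Λ → Λ → Λ} {p : Λ → Prop} (hp : ∀ x y, p x → p y → p (op x y))
    (c : ℕ → ℂ) (S : Submodule ℂ E) {F : List Λ → E} (hF : ∀ l, (∀ x ∈ l, p x) → F l ∈ S)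
    {l : List Λ} (hl : ∀ x ∈ l, p x) : contractSum op c F l ∈ S := by
  cases l with
  | nil => exact hF _ (by simp)
  | cons x l =>
    rw [List.forall_mem_cons] at hl
    exact blockSum_mem hp c S l hl.2 _ _ _ hl.1 hF

/-- The sum over all letters of a list of the weight of the letter times the value of `F` with
this letter lowered. -/
def lowerSum (wt : Λ → ℂ) (dn : Λ → Λ) (F : List Λ → E) (l : List Λ) : E :=
  ∑ j : Fin l.length, wt l[j] • F (l.set j (dn l[j]))

@[simp]
theorem lowerSum_nil (wt : Λ → ℂ) (dn : Λ → Λ) (F : List Λ → E) : lowerSum wt dn F [] = 0 := by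
  simp [lowerSum]

theorem lowerSum_cons (wt : Λ → ℂ) (dn : Λ → Λ) (F : List Λ → E) (x : Λ) (l : List Λ) :
    lowerSum wt dn F (x :: l) =
      wt x • F (dn x :: l) + lowerSum wt dn (fun l' => F (x :: l')) l := by
  unfold lowerSum
  exact Fin.sum_univ_succ (n := l.length)
    (fun j => wt (x :: l)[j] • F ((x :: l).set j (dn (x :: l)[j])))

theorem lowerSum_add (wt : Λ → ℂ) (dn : Λ → Λ) (F G : List Λ → E) (l : List Λ) :
    lowerSum wt dn (fun l => F l + G l) l = lowerSum wt dn F l + lowerSum wt dn G l := by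
  simp [lowerSum, smul_add, Finset.sum_add_distrib]

theorem lowerSum_smul (wt : Λ → ℂ) (dn : Λ → Λ) (a : ℂ) (F : List Λ → E) (l : List Λ) :
    lowerSum wt dn (fun l => a • F l) l = a • lowerSum wt dn F l := by
  simp only [lowerSum, Finset.smul_sum]
  exact Finset.sum_congr rfl fun j _ => smul_comm _ _ _

theorem lowerSum_map {wt : Λ → ℂ} {dn : Λ → Λ} {wt' : Λ' → ℂ} {dn' : Λ' → Λ'} {φ : Λ → Λ'}
    (h1 : ∀ x, wt' (φ x) = wt x) (h2 : ∀ x, dn' (φ x) = φ (dn x)) (l : List Λ) :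
    ∀ (F : List Λ' → E),
    lowerSum wt' dn' F (l.map φ) = lowerSum wt dn (fun l => F (l.map φ)) l := by
  induction l with
  | nil => intro F; simp
  | cons x l ih =>
    intro F
    rw [List.map_cons, lowerSum_cons, lowerSum_cons, ih, h1, h2]
    rfl

/-- Lowering one letter of a block lowers the merged letter, and the weights of the letters of a
block add up to the weight of the block. Compatibility of `op` with `dn` is only asked for letters
of nonzero weight because `dn` will be truncated subtraction, which fails to commute with addition
at `0`. -/
theorem lowerSum_blockSum {op : Λ → Λ → Λ} {wt : Λ → ℂ} {dn : Λ → Λ}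
    (hwt : ∀ x y, wt (op x y) = wt x + wt y)
    (hl : ∀ x y, wt x ≠ 0 → op (dn x) y = dn (op x y))
    (hr : ∀ x y, wt y ≠ 0 → op x (dn y) = dn (op x y)) (c : ℕ → ℂ) (l : List Λ) :
    ∀ (m : ℕ) (s : Λ) (F : List Λ → E),
    wt s • blockSum op c m (dn s) l F + lowerSum wt dn (fun l => blockSum op c m s l F) l =
      blockSum op c m s l (lowerSum wt dn F) := by
  induction l with
  | nil =>
    intro m s F
    simp only [blockSum, lowerSum_nil, lowerSum_cons, add_zero]
    exact smul_comm _ _ _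
  | cons y l ih =>
    intro m s F
    have e1 : ∀ F G : List Λ → E, ∀ m s, blockSum op c m s l (fun l => F l + G l) =
        blockSum op c m s l F + blockSum op c m s l G := by
      intro F G m s
      have h := map_blockSum op c (LinearMap.fst ℂ E E + LinearMap.snd ℂ E E) l m s
        (fun l => (F l, G l))
      simp only [LinearMap.add_apply, LinearMap.fst_apply, LinearMap.snd_apply] at h
      rw [← h]
      congr 1
      · exact map_blockSum op c (LinearMap.fst ℂ E E) l m s (fun l => (F l, G l))
      · exact map_blockSum op c (LinearMap.snd ℂ E E) l m s (fun l => (F l, G l))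
    have e2 : ∀ (a : ℂ) (F : List Λ → E) m s, blockSum op c m s l (fun l => a • F l) =
        a • blockSum op c m s l F :=
      fun a F m s => (map_blockSum op c (LinearMap.lsmul ℂ E a) l m s F).symm
    have e3 : wt s • blockSum op c (m + 1) (op (dn s) y) l F =
        wt s • blockSum op c (m + 1) (dn (op s y)) l F := by
      by_cases h : wt s = 0
      · simp [h]
      · rw [hl _ _ h]
    have e4 : wt y • blockSum op c (m + 1) (op s (dn y)) l F =
        wt y • blockSum op c (m + 1) (dn (op s y)) l F := by
      by_cases h : wt y = 0
      · simp [h]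
      · rw [hr _ _ h]
    have i1 := ih (m + 1) (op s y) F
    have i2 := ih 1 y (fun l' => F (s :: l'))
    simp only [blockSum, lowerSum_cons, smul_add, lowerSum_add, lowerSum_smul, e1, e2]
    rw [← i1, ← i2, e3, e4, hwt, add_smul, smul_add, smul_comm (c m) (wt s),
      smul_comm (c m) (wt y)]
    abel

theorem lowerSum_contractSum {op : Λ → Λ → Λ} {wt : Λ → ℂ} {dn : Λ → Λ}
    (hwt : ∀ x y, wt (op x y) = wt x + wt y)
    (hl : ∀ x y, wt x ≠ 0 → op (dn x) y = dn (op x y))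
    (hr : ∀ x y, wt y ≠ 0 → op x (dn y) = dn (op x y)) (c : ℕ → ℂ) (F : List Λ → E)
    (l : List Λ) :
    lowerSum wt dn (contractSum op c F) l = contractSum op c (lowerSum wt dn F) l := by
  cases l with
  | nil => simp [contractSum]
  | cons x l =>
    rw [lowerSum_cons]
    exact lowerSum_blockSum hwt hl hr c l 1 x F

/-! ### Convolution, and contraction weights as coefficients of power series. -/

/-- The convolution product for deconcatenation. -/
def conv : (List Λ → ℂ) → (List Λ → ℂ) → List Λ → ℂ
  | F, G, [] => F [] * G []
  | F, G, x :: l => F [] * G (x :: l) + conv (fun l' => F (x :: l')) G l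

theorem conv_add_left (F F' G : List Λ → ℂ) (l : List Λ) :
    conv (fun l => F l + F' l) G l = conv F G l + conv F' G l := by
  induction l generalizing F F' with
  | nil => simp [conv, add_mul]
  | cons x l ih => simp only [conv, ih]; ring

theorem conv_smul_left (a : ℂ) (F G : List Λ → ℂ) (l : List Λ) :
    conv (fun l => a * F l) G l = a * conv F G l := by
  induction l generalizing F with
  | nil => simp [conv, mul_assoc]
  | cons x l ih => simp only [conv, ih]; ring

/-- A cut of a contracted list lies between two blocks, so it comes from a cut of the original list
together with a contraction of each side. -/
theorem blockSum_conv (op : Λ → Λ → Λ) (c : ℕ → ℂ) (l : List Λ) :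
    ∀ (m : ℕ) (s : Λ) (F G : List Λ → ℂ),
    blockSum op c m s l (conv F G) = F [] * blockSum op c m s l G +
      conv (fun l' => blockSum op c m s l' F) (contractSum op c G) l := by
  induction l with
  | nil =>
    intro m s F G
    simp only [blockSum, conv, contractSum, smul_eq_mul]
    ring
  | cons y l ih =>
    intro m s F G
    have h := map_blockSum op c (E := ℂ × ℂ) (F [] • LinearMap.fst ℂ ℂ ℂ + LinearMap.snd ℂ ℂ ℂ)
      l 1 y (fun l' => (G (s :: l'), conv (fun l => F (s :: l)) G l'))
    have h1 := map_blockSum op c (LinearMap.fst ℂ ℂ ℂ) l 1 y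
      (fun l' => (G (s :: l'), conv (fun l => F (s :: l)) G l'))
    have h2 := map_blockSum op c (LinearMap.snd ℂ ℂ ℂ) l 1 y
      (fun l' => (G (s :: l'), conv (fun l => F (s :: l)) G l'))
    simp only [LinearMap.add_apply, LinearMap.smul_apply, smul_eq_mul, h1, h2] at h
    simp only [LinearMap.fst_apply, LinearMap.snd_apply] at h
    simp only [blockSum, conv, ← h, ih, conv_add_left, smul_eq_mul, conv_smul_left]
    simp only [contractSum]
    ring

/-- Contraction sums are multiplicative for the convolution dual to deconcatenation. -/
theorem contractSum_conv (op : Λ → Λ → Λ) (c : ℕ → ℂ) (F G : List Λ → ℂ) (l : List Λ) :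
    contractSum op c (conv F G) l = conv (contractSum op c F) (contractSum op c G) l := by
  cases l with
  | nil => rfl
  | cons x l => exact blockSum_conv op c l 1 x F G

/-- A functional on lists with the weight `h k` on lists of length `k`, and `χ` on letters. -/
def weighted (χ : Λ → ℂ) (h : ℕ → ℂ) (l : List Λ) : ℂ := (l.map χ).prod * h l.length

/-- The power series `∑_{i ≥ 1} c i X ^ i`. -/
def genSeries (c : ℕ → ℂ) : PowerSeries ℂ := PowerSeries.mk fun i => if i = 0 then 0 else c i

theorem coeff_genSeries_pow (c : ℕ → ℂ) {n r : ℕ} (h : n < r) :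
    PowerSeries.coeff n (genSeries c ^ r) = 0 := by
  refine PowerSeries.coeff_of_lt_order _ (lt_of_lt_of_le ?_
    (PowerSeries.le_order_pow_of_constantCoeff_eq_zero r ?_))
  · exact_mod_cast h
  · simp [genSeries]

/-- This is the coefficient form of `genSeries c ^ (r + 1) = genSeries c * genSeries c ^ r`, the
index `i` describing the size of the first block. Truncation at `K` loses nothing, since the series
has no constant term. -/
theorem sum_coeff_genSeries_pow (c h : ℕ → ℂ) {n K : ℕ} (hK : n + 1 < K) :
    ∑ i ∈ Finset.range (n + 1), c (1 + i) * ∑ r ∈ Finset.range K,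
        h (r + 1) * PowerSeries.coeff (n - i) (genSeries c ^ r) =
      ∑ r ∈ Finset.range K, h r * PowerSeries.coeff (n + 1) (genSeries c ^ r) := by
  have e4 : ∀ r, PowerSeries.coeff (n + 1) (genSeries c ^ (r + 1)) =
      ∑ i ∈ Finset.range (n + 1), c (1 + i) * PowerSeries.coeff (n - i) (genSeries c ^ r) := by
    intro r
    rw [pow_succ', PowerSeries.coeff_mul,
      Finset.Nat.sum_antidiagonal_eq_sum_range_succ (fun i j =>
        PowerSeries.coeff i (genSeries c) * PowerSeries.coeff j (genSeries c ^ r)),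
      Finset.sum_range_succ']
    simp [genSeries, add_comm]
  obtain ⟨K, rfl⟩ : ∃ k, K = k + 1 := ⟨K - 1, by omega⟩
  rw [Finset.sum_range_succ' _ K]
  simp only [e4, pow_zero, PowerSeries.coeff_one, Nat.succ_ne_zero, if_false, mul_zero,
    add_zero, Finset.mul_sum]
  rw [Finset.sum_comm, Finset.sum_range_succ, add_eq_left.2]
  · exact Finset.sum_congr rfl fun r _ => Finset.sum_congr rfl fun i _ => by ring
  · refine Finset.sum_eq_zero fun i _ => ?_
    rw [coeff_genSeries_pow c (by omega), mul_zero, mul_zero]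

/-- With `χ` multiplicative the letters factor out and only block sizes matter. Here `i` is the
number of further letters absorbed by the first block, and the others form `r` blocks, of total
weight a coefficient of `genSeries c ^ r`. -/
theorem blockSum_weighted {op : Λ → Λ → Λ} {χ : Λ → ℂ} (hχ : ∀ x y, χ (op x y) = χ x * χ y)
    (c : ℕ → ℂ) (K : ℕ) (l : List Λ) : ∀ (m : ℕ) (s : Λ) (h : ℕ → ℂ), l.length < K →
    blockSum op c (m + 1) s l (weighted χ h) = χ s * (l.map χ).prod *
      ∑ i ∈ Finset.range (l.length + 1), c (m + 1 + i) *
        ∑ r ∈ Finset.range K, h (r + 1) * PowerSeries.coeff (l.length - i) (genSeries c ^ r) := by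
  induction l with
  | nil =>
    intro m s h hK
    obtain ⟨K, rfl⟩ : ∃ k, K = k + 1 := ⟨K - 1, by simp at hK; omega⟩
    simp only [blockSum, weighted, List.map_cons, List.map_nil, List.prod_cons, List.prod_nil,
      List.length_cons, List.length_nil, zero_add, Finset.sum_range_one, smul_eq_mul, zero_tsub,
      add_zero, mul_one]
    rw [Finset.sum_range_succ', Finset.sum_eq_zero]
    · simp
      ring
    · intro r _
      rw [coeff_genSeries_pow c (Nat.succ_pos r), mul_zero]
  | cons y l ih =>
    intro m s h hK
    rw [List.length_cons] at hK
    have e1 : (fun l' => weighted χ h (s :: l')) =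
        fun l' => χ s • weighted χ (fun k => h (k + 1)) l' := by
      funext l'
      simp only [weighted, List.map_cons, List.prod_cons, List.length_cons, smul_eq_mul]
      ring
    have e2 := map_blockSum op c (LinearMap.lsmul ℂ ℂ (χ s)) l 1 y
      (weighted χ (fun k => h (k + 1)))
    simp only [LinearMap.lsmul_apply] at e2
    rw [blockSum, e1, ← e2, ← zero_add 1, ih 0 y _ (by omega), ih (m + 1) _ _ (by omega),
      List.length_cons, Finset.sum_range_succ' _ (l.length + 1), hχ, List.map_cons, List.prod_cons]
    simp only [smul_eq_mul, zero_add, add_zero, tsub_zero, Nat.add_sub_add_right]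
    have e5 : ∀ i, m + 1 + 1 + i = m + 1 + (i + 1) := fun i => by omega
    rw [sum_coeff_genSeries_pow c (fun r => h (r + 1)) hK]
    simp only [e5]
    ring

theorem contractSum_weighted {op : Λ → Λ → Λ} {χ : Λ → ℂ} (hχ : ∀ x y, χ (op x y) = χ x * χ y)
    (c : ℕ → ℂ) (h : ℕ → ℂ) (l : List Λ) {K : ℕ} (hK : l.length < K) :
    contractSum op c (weighted χ h) l =
      weighted χ (fun n => ∑ r ∈ Finset.range K, h r * PowerSeries.coeff n (genSeries c ^ r)) l := by
  cases l with
  | nil =>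
    obtain ⟨K, rfl⟩ : ∃ k, K = k + 1 := ⟨K - 1, by simp at hK; omega⟩
    simp only [contractSum, weighted, List.map_nil, List.prod_nil, List.length_nil, one_mul]
    rw [Finset.sum_range_succ', Finset.sum_eq_zero]
    · simp
    · intro r _
      rw [coeff_genSeries_pow c (Nat.succ_pos r), mul_zero]
  | cons x l =>
    rw [List.length_cons] at hK
    rw [contractSum, ← zero_add 1, blockSum_weighted hχ c K l 0 x h (by omega), weighted,
      List.length_cons, ← sum_coeff_genSeries_pow c h hK, List.map_cons, List.prod_cons]

/-- The coefficients of Hoffman's exponential. -/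
def expCoeff (i : ℕ) : ℂ := ((i.factorial : ℕ) : ℂ)⁻¹

/-- The coefficients of Hoffman's logarithm. -/
def logCoeff (i : ℕ) : ℂ := (-1) ^ (i - 1) * (i : ℂ)⁻¹

/-- Only `r = 0` and `r = 1` contribute: the generating series becomes `1 + (exp X - 1)`. -/
theorem contractSum_expCoeff {op : Λ → Λ → Λ} {χ : Λ → ℂ} (hχ : ∀ x y, χ (op x y) = χ x * χ y)
    (l : List Λ) :
    contractSum op expCoeff (weighted χ fun n => if n ≤ 1 then 1 else 0) l =
      weighted χ expCoeff l := by
  rw [contractSum_weighted hχ _ _ l (K := l.length + 2) (by omega)]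
  unfold weighted
  congr 1
  beta_reduce
  rw [Finset.sum_range_succ', Finset.sum_range_succ', Finset.sum_eq_zero]
  · rcases l with _ | ⟨x, l⟩
    · simp [expCoeff, genSeries]
    · simp [expCoeff, genSeries, PowerSeries.coeff_one]
  · intro r _
    simp

open PowerSeries in
theorem one_add_X_mul_derivative_genSeries_logCoeff :
    (1 + X) * derivative ℂ (genSeries logCoeff) = 1 := by
  ext n
  rw [add_mul, one_mul, map_add]
  have h : ∀ n, coeff n (derivative ℂ (genSeries logCoeff)) = (-1) ^ n := by
    intro n
    rw [coeff_derivative]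
    have : (n : ℂ) + 1 ≠ 0 := by exact_mod_cast n.succ_ne_zero
    simp only [genSeries, coeff_mk, Nat.succ_ne_zero, if_false, logCoeff, Nat.add_sub_cancel]
    push_cast
    field_simp
  cases n with
  | zero => simp [h]
  | succ n => rw [coeff_succ_X_mul, h, h, coeff_one, if_neg n.succ_ne_zero]; ring

open PowerSeries in
/-- `exp (log (1 + X)) = 1 + X`, by truncations of the exponential. -/
theorem sum_expCoeff_mul_coeff (n : ℕ) : ∀ K : ℕ, n < K →
    ∑ r ∈ Finset.range K, expCoeff r * coeff n (genSeries logCoeff ^ r) =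
      if n ≤ 1 then 1 else 0 := by
  set L := genSeries logCoeff with hL
  let S : ℕ → PowerSeries ℂ := fun K => ∑ r ∈ Finset.range K, expCoeff r • L ^ r
  have hS : ∀ n K, ∑ r ∈ Finset.range K, expCoeff r * coeff n (L ^ r) = coeff n (S K) := by
    intro n K
    simp [S, map_sum]
  -- The truncated form of `(1 + X) S' = S`. In coefficients it reads `(n + 1) s (n + 1) = (1 - n) s
  -- n`, so `s 0 = 1` forces `1 + X`.
  have hd : ∀ K, (1 + X) * derivative ℂ (S (K + 1)) = S K := by
    intro K
    have : derivative ℂ (S (K + 1)) = derivative ℂ L * S K := by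
      simp only [S]
      rw [Finset.sum_range_succ', map_add, map_sum, Finset.mul_sum]
      simp only [Derivation.map_smul, pow_zero, Derivation.map_one_eq_zero, smul_zero, add_zero]
      refine Finset.sum_congr rfl fun r _ => ?_
      rw [Derivation.leibniz_pow, Nat.add_sub_cancel, expCoeff, expCoeff, Nat.factorial_succ,
        smul_eq_mul, mul_smul_comm, ← Nat.cast_smul_eq_nsmul ℂ, smul_smul, mul_comm (L ^ r)]
      congr 1
      have : (r : ℂ) + 1 ≠ 0 := by exact_mod_cast r.succ_ne_zero
      have : (r.factorial : ℂ) ≠ 0 := by exact_mod_cast r.factorial_ne_zero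
      push_cast
      field_simp
    rw [this, ← mul_assoc, one_add_X_mul_derivative_genSeries_logCoeff, one_mul]
  have hstab : ∀ n K, n < K → coeff n (S (K + 1)) = coeff n (S K) := by
    intro n K h
    rw [← hS, ← hS, Finset.sum_range_succ, coeff_genSeries_pow _ h, mul_zero, add_zero]
  simp only [hS]
  induction n with
  | zero =>
    intro K hK
    obtain ⟨K, rfl⟩ : ∃ k, K = k + 1 := ⟨K - 1, by omega⟩
    rw [← hS, Finset.sum_range_succ', Finset.sum_eq_zero]
    · simp [expCoeff]
    · intro r _
      rw [coeff_genSeries_pow _ (Nat.succ_pos r), mul_zero]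
  | succ n ih =>
    intro K hK
    have h1 := congrArg (coeff n) (hd K)
    rw [add_mul, one_mul, map_add, coeff_derivative, ih K (by omega), hstab _ _ hK] at h1
    have h2 : coeff n (X * derivative ℂ (S (K + 1))) = n * coeff n (S K) := by
      cases n with
      | zero => simp
      | succ n =>
        rw [coeff_succ_X_mul, coeff_derivative, hstab _ _ (by omega)]
        push_cast
        ring
    rw [h2, ih K (by omega)] at h1
    have : (n : ℂ) + 1 ≠ 0 := by exact_mod_cast n.succ_ne_zero
    rcases n with _ | _ | n
    · simpa using h1
    · simp only [zero_add, le_refl, if_true, Nat.cast_one, mul_one] at h1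
      have h3 : coeff (1 + 1) (S K) * (1 + 1) = 0 := by linear_combination h1
      simpa using h3
    · simp only [show ¬ n + 1 + 1 ≤ 1 by omega, if_false, mul_zero, add_zero] at h1
      rw [if_neg (by omega)]
      exact (mul_eq_zero.1 h1).resolve_right this

theorem contractSum_logCoeff {op : Λ → Λ → Λ} {χ : Λ → ℂ} (hχ : ∀ x y, χ (op x y) = χ x * χ y)
    (l : List Λ) :
    contractSum op logCoeff (weighted χ expCoeff) l =
      weighted χ (fun n => if n ≤ 1 then 1 else 0) l := by
  rw [contractSum_weighted hχ _ _ l (K := l.length + 1) (by omega)]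
  unfold weighted
  beta_reduce
  rw [sum_expCoeff_mul_coeff _ _ (by omega)]

theorem conv_map (φ : Λ → Λ') (l : List Λ) : ∀ F G : List Λ' → ℂ,
    conv F G (l.map φ) = conv (fun l => F (l.map φ)) (fun l => G (l.map φ)) l := by
  induction l with
  | nil => intro F G; rfl
  | cons x l ih => intro F G; simp only [List.map_cons, List.map_nil, conv, ih]

/-- The second factor sees only suffixes of length at most one, so just two cuts survive: none, or
the one before the last letter. -/
theorem conv_weighted_append (χ : Λ → ℂ) (x : Λ) (l : List Λ) : ∀ F : List Λ → ℂ,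
    conv F (weighted χ fun n => if n ≤ 1 then 1 else 0) (l ++ [x]) = F (l ++ [x]) + χ x * F l := by
  induction l with
  | nil =>
    intro F
    simp [conv, weighted]
    ring
  | cons y l ih =>
    intro F
    simp [conv, ih, weighted]

theorem conv_weighted_nil (χ : Λ → ℂ) (F : List Λ → ℂ) :
    conv F (weighted χ fun n => if n ≤ 1 then 1 else 0) [] = F [] := by
  simp [conv, weighted]

/-! ### Twisting functionals by the exponential and the logarithm. -/

/-- The functional `F ∘ exp ∘ ρ ∘ log` on lists, with `ρ` acting on letters. -/
def twisted (op : Λ → Λ → Λ) (op' : Λ' → Λ' → Λ') (ρ : Λ → Λ') (F : List Λ' → E)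
    (l : List Λ) : E :=
  contractSum op logCoeff (fun l => contractSum op' expCoeff F (l.map ρ)) l

theorem twisted_mem {op : Λ → Λ → Λ} {op' : Λ' → Λ' → Λ'} {ρ : Λ → Λ'} {p : Λ → Prop}
    {p' : Λ' → Prop} (hp : ∀ x y, p x → p y → p (op x y))
    (hp' : ∀ x y, p' x → p' y → p' (op' x y)) (hρ : ∀ x, p x → p' (ρ x)) (S : Submodule ℂ E)
    {F : List Λ' → E} (hF : ∀ l, (∀ x ∈ l, p' x) → F l ∈ S) {l : List Λ} (hl : ∀ x ∈ l, p x) :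
    twisted op op' ρ F l ∈ S :=
  contractSum_mem hp _ S (fun l hl => contractSum_mem hp' _ S hF (by
    intro y hy
    obtain ⟨x, hx, rfl⟩ := List.mem_map.1 hy
    exact hρ x (hl x hx))) hl

theorem map_twisted (op : Λ → Λ → Λ) (op' : Λ' → Λ' → Λ') (ρ : Λ → Λ') (f : E →ₗ[ℂ] E')
    (F : List Λ' → E) (l : List Λ) :
    f (twisted op op' ρ F l) = twisted op op' ρ (fun l => f (F l)) l := by
  unfold twisted
  rw [map_contractSum]
  simp only [map_contractSum]

/-- Both contraction sums distribute over the convolution. On the second factor `exp` produces the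
weights `1 / n!`, and `log` undoes this because `χ ∘ ρ` is again multiplicative; the second factor
therefore comes out with its original shape. -/
theorem twisted_append {op : Λ → Λ → Λ} {op' : Λ' → Λ' → Λ'} {ρ : Λ → Λ'} {χ : Λ' → ℂ}
    (hχ : ∀ x y, χ (op' x y) = χ x * χ y) (hρ : ∀ x y, χ (ρ (op x y)) = χ (ρ x) * χ (ρ y))
    (F : List Λ' → ℂ) (l : List Λ) (x : Λ) :
    twisted op op' ρ (conv F (weighted χ fun n => if n ≤ 1 then 1 else 0)) (l ++ [x]) =
      twisted op op' ρ F (l ++ [x]) + χ (ρ x) * twisted op op' ρ F l := by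
  have h1 : contractSum op' expCoeff (conv F (weighted χ fun n => if n ≤ 1 then 1 else 0)) =
      conv (contractSum op' expCoeff F) (weighted χ expCoeff) := by
    funext l
    rw [contractSum_conv]
    congr 1
    funext l
    exact contractSum_expCoeff hχ l
  have h2 : (fun l : List Λ => weighted χ expCoeff (l.map ρ)) =
      weighted (fun x => χ (ρ x)) expCoeff := by
    funext l
    simp [weighted, Function.comp_def]
  unfold twisted
  simp only [h1, conv_map, h2]
  change contractSum op logCoeff (conv _ _) _ = _
  rw [contractSum_conv]
  have h3 : contractSum op logCoeff (weighted (fun x => χ (ρ x)) expCoeff) =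
      weighted (fun x => χ (ρ x)) (fun n => if n ≤ 1 then 1 else 0) := by
    funext l
    exact contractSum_logCoeff hρ l
  rw [h3, conv_weighted_append]

theorem lowerSum_twisted {op : Λ → Λ → Λ} {op' : Λ' → Λ' → Λ'} {ρ : Λ → Λ'} {wt : Λ → ℂ}
    {dn : Λ → Λ} {wt' : Λ' → ℂ} {dn' : Λ' → Λ'}
    (hwt : ∀ x y, wt (op x y) = wt x + wt y)
    (hl : ∀ x y, wt x ≠ 0 → op (dn x) y = dn (op x y))
    (hr : ∀ x y, wt y ≠ 0 → op x (dn y) = dn (op x y))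
    (hwt' : ∀ x y, wt' (op' x y) = wt' x + wt' y)
    (hl' : ∀ x y, wt' x ≠ 0 → op' (dn' x) y = dn' (op' x y))
    (hr' : ∀ x y, wt' y ≠ 0 → op' x (dn' y) = dn' (op' x y))
    (h1 : ∀ x, wt' (ρ x) = wt x) (h2 : ∀ x, dn' (ρ x) = ρ (dn x)) (F : List Λ' → E)
    (l : List Λ) :
    lowerSum wt dn (twisted op op' ρ F) l = twisted op op' ρ (lowerSum wt' dn' F) l := by
  have h : twisted op op' ρ F =
      contractSum op logCoeff (fun l => contractSum op' expCoeff F (l.map ρ)) := rfl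
  rw [h, lowerSum_contractSum hwt hl hr]
  unfold twisted
  congr 1
  funext l
  rw [← lowerSum_contractSum hwt' hl' hr']
  exact (lowerSum_map h1 h2 l _).symm

end ContractionSums

/-! ### Binomial expansion with an explicit remainder bound. -/

/-- The falling factorial `α (α - 1) ⋯ (α - i + 1)`. -/
def fallFact (α : ℂ) (i : ℕ) : ℂ := ∏ m ∈ Finset.range i, (α - m)

theorem fallFact_succ (α : ℂ) (i : ℕ) : fallFact α (i + 1) = fallFact α i * (α - i) :=
  Finset.prod_range_succ _ _

theorem fallFact_succ' (α : ℂ) (i : ℕ) : fallFact α (i + 1) = α * fallFact (α - 1) i := by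
  unfold fallFact
  rw [Finset.prod_range_succ', mul_comm]
  congr 1
  · simp
  · refine Finset.prod_congr rfl fun m _ => ?_
    push_cast
    ring

/-- The remainder of order `n` in the binomial expansion of `(1 + t) ^ α`. -/
def binomRem (α : ℂ) (n : ℕ) (t : ℝ) : ℂ :=
  Complex.exp (α * (Real.log (1 + t) : ℝ)) -
    ∑ i ∈ Finset.range n, fallFact α i / (i.factorial : ℂ) * (t : ℂ) ^ i

theorem hasDerivAt_exp_log {a t : ℝ} (h : 0 < a + t) (α : ℂ) :
    HasDerivAt (fun t : ℝ => Complex.exp (α * (Real.log (a + t) : ℝ)))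
      (α * Complex.exp ((α - 1) * (Real.log (a + t) : ℝ))) t := by
  have h1 : HasDerivAt (fun t : ℝ => Real.log (a + t)) (1 / (a + t)) t :=
    ((hasDerivAt_id t).const_add a).log h.ne'
  have h2 := ((h1.ofReal_comp).const_mul α).cexp
  convert h2 using 1
  have h3 : Complex.exp (-((Real.log (a + t) : ℝ) : ℂ)) = ((1 / (a + t) : ℝ) : ℂ) := by
    rw [← Complex.ofReal_neg, ← Complex.ofReal_exp, Real.exp_neg, Real.exp_log h, one_div]
  rw [sub_mul, one_mul, sub_eq_add_neg, Complex.exp_add, h3]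
  ring

theorem hasDerivAt_binomRem (α : ℂ) (n : ℕ) {t : ℝ} (ht : 0 ≤ t) :
    HasDerivAt (binomRem α (n + 1)) (α * binomRem (α - 1) n t) t := by
  have h1 := hasDerivAt_exp_log (a := 1) (t := t) (by linarith) α
  have h2 : HasDerivAt (fun t : ℝ => ∑ i ∈ Finset.range (n + 1),
      fallFact α i / (i.factorial : ℂ) * (t : ℂ) ^ i)
      (∑ i ∈ Finset.range (n + 1), fallFact α i / (i.factorial : ℂ) *
        ((i : ℂ) * (t : ℂ) ^ (i - 1))) t := by
    refine HasDerivAt.fun_sum fun i _ => ?_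
    have := ((hasDerivAt_pow i (t : ℂ)).comp_ofReal).const_mul (fallFact α i / (i.factorial : ℂ))
    exact this
  refine HasDerivAt.congr_deriv (f := binomRem α (n + 1)) (h1.sub h2) ?_
  unfold binomRem
  rw [mul_sub]
  congr 1
  rw [Finset.sum_range_succ', Finset.mul_sum]
  simp only [Nat.cast_zero, zero_mul, mul_zero, add_zero]
  refine Finset.sum_congr rfl fun i _ => ?_
  rw [fallFact_succ', Nat.factorial_succ, Nat.add_sub_cancel]
  have : (i.factorial : ℂ) ≠ 0 := by exact_mod_cast i.factorial_ne_zero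
  have : (i : ℂ) + 1 ≠ 0 := by exact_mod_cast i.succ_ne_zero
  push_cast
  field_simp

/-- The remainder vanishes at `t = 0` and its derivative is `α` times the remainder of lower order
for `α - 1`, so the mean value inequality gives an induction. The constant depends on `‖α‖`, `n` and
`T` only, which makes it uniform over compact sets of parameters. -/
theorem norm_binomRem_le (n : ℕ) : ∀ (α : ℂ) {t T : ℝ}, 0 ≤ t → t ≤ T →
    ‖binomRem α n t‖ ≤ (‖α‖ + n) ^ n * (1 + T) ^ (‖α‖ + n) * t ^ n := by
  induction n with
  | zero =>
    intro α t T ht hT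
    simp only [binomRem, Finset.range_zero, Finset.sum_empty, sub_zero, Nat.cast_zero, add_zero,
      pow_zero, one_mul, mul_one]
    rw [Complex.norm_exp, Complex.re_mul_ofReal]
    have h0 : 0 ≤ Real.log (1 + t) := Real.log_nonneg (by linarith)
    calc Real.exp (α.re * Real.log (1 + t)) ≤ Real.exp (‖α‖ * Real.log (1 + t)) := by
          gcongr
          exact Complex.re_le_norm α
      _ = (1 + t) ^ ‖α‖ := by rw [Real.rpow_def_of_pos (by linarith), mul_comm]
      _ ≤ (1 + T) ^ ‖α‖ := by gcongr
  | succ n ih =>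
    intro α t T ht hT
    have hT0 : 0 ≤ T := ht.trans hT
    have h0 : binomRem α (n + 1) 0 = 0 := by
      rw [binomRem, Finset.sum_range_succ', Finset.sum_eq_zero]
      · simp [fallFact]
      · intro i _
        simp
    have h1 := norm_image_sub_le_of_norm_deriv_le_segment' (a := 0) (b := t)
      (f := binomRem α (n + 1)) (f' := fun x => α * binomRem (α - 1) n x)
      (C := ‖α‖ * ((‖α - 1‖ + n) ^ n * (1 + T) ^ (‖α - 1‖ + n) * t ^ n))
      (fun x hx => (hasDerivAt_binomRem α n hx.1).hasDerivWithinAt)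
      (fun x hx => by
        rw [norm_mul]
        have hx0 := hx.1
        refine mul_le_mul_of_nonneg_left ((ih (α - 1) hx.1 (hx.2.le.trans hT)).trans ?_)
          (norm_nonneg _)
        gcongr
        exact hx.2.le) t ⟨ht, le_rfl⟩
    rw [h0, sub_zero, sub_zero] at h1
    refine h1.trans ?_
    have h2 : ‖α - 1‖ + n ≤ ‖α‖ + (n + 1 : ℕ) := by
      have := norm_sub_le α 1
      rw [norm_one] at this
      push_cast
      linarith
    have h3 : ‖α‖ ≤ ‖α‖ + (n + 1 : ℕ) := by
      have : (0 : ℝ) ≤ (n + 1 : ℕ) := by positivity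
      linarith
    calc ‖α‖ * ((‖α - 1‖ + n) ^ n * (1 + T) ^ (‖α - 1‖ + n) * t ^ n) * t
        ≤ (‖α‖ + (n + 1 : ℕ)) * ((‖α‖ + (n + 1 : ℕ)) ^ n *
            (1 + T) ^ (‖α‖ + (n + 1 : ℕ)) * t ^ n) * t := by
          gcongr
          linarith
      _ = _ := by ring

/-! ### Coefficients depending on parameters, uniform bounds and expansions in powers of `n`. -/

section Box

variable {ε V : ℝ}

/-- The parameters `(g, v)`, `|g| ≤ ε` and `0 ≤ v ≤ V`. -/
def box (ε V : ℝ) : Set (ℂ × ℝ) := Metric.closedBall 0 ε ×ˢ Icc 0 V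

theorem isCompact_box (ε V : ℝ) : IsCompact (box ε V) :=
  (isCompact_closedBall 0 ε).prod isCompact_Icc

theorem norm_fst_le_of_mem_box {p : ℂ × ℝ} (hp : p ∈ box ε V) : ‖p.1‖ ≤ ε := by
  simpa using hp.1

theorem mk_mem_box {g : ℂ} {v : ℝ} (hg : g ∈ Metric.ball (0 : ℂ) ε) (hv : v ∈ Icc 0 V) :
    (g, v) ∈ box ε V := ⟨Metric.ball_subset_closedBall hg, hv⟩

/-- Coefficients that are continuous in `(g, v)` and holomorphic in `g`. -/
structure Good (ε V : ℝ) (c : ℂ × ℝ → ℂ) : Prop where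
  cont : ContinuousOn c (box ε V)
  diff : ∀ v ∈ Icc 0 V, DifferentiableOn ℂ (fun g => c (g, v)) (Metric.ball 0 ε)

theorem Good.const (a : ℂ) : Good ε V fun _ => a :=
  ⟨continuousOn_const, fun _ _ => differentiableOn_const _⟩

theorem Good.fst : Good ε V fun p => p.1 :=
  ⟨continuousOn_fst, fun _ _ => differentiableOn_id⟩

theorem Good.snd : Good ε V fun p => (p.2 : ℂ) :=
  ⟨(Complex.continuous_ofReal.comp continuous_snd).continuousOn,
    fun v _ => differentiableOn_const (v : ℂ)⟩

theorem Good.add {c d : ℂ × ℝ → ℂ} (hc : Good ε V c) (hd : Good ε V d) :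
    Good ε V fun p => c p + d p :=
  ⟨hc.cont.add hd.cont, fun v hv => (hc.diff v hv).add (hd.diff v hv)⟩

theorem Good.mul {c d : ℂ × ℝ → ℂ} (hc : Good ε V c) (hd : Good ε V d) :
    Good ε V fun p => c p * d p :=
  ⟨hc.cont.mul hd.cont, fun v hv => (hc.diff v hv).mul (hd.diff v hv)⟩

theorem Good.neg {c : ℂ × ℝ → ℂ} (hc : Good ε V c) : Good ε V fun p => -c p :=
  ⟨hc.cont.neg, fun v hv => (hc.diff v hv).neg⟩

theorem Good.sub {c d : ℂ × ℝ → ℂ} (hc : Good ε V c) (hd : Good ε V d) :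
    Good ε V fun p => c p - d p :=
  ⟨hc.cont.sub hd.cont, fun v hv => (hc.diff v hv).sub (hd.diff v hv)⟩

theorem Good.inv {c : ℂ × ℝ → ℂ} (hc : Good ε V c) (h : ∀ p ∈ box ε V, c p ≠ 0) :
    Good ε V fun p => (c p)⁻¹ :=
  ⟨hc.cont.inv₀ h, fun v hv => (hc.diff v hv).inv fun _ hg => h _ (mk_mem_box hg hv)⟩

theorem Good.exp {c : ℂ × ℝ → ℂ} (hc : Good ε V c) : Good ε V fun p => Complex.exp (c p) :=
  ⟨hc.cont.cexp, fun v hv => (hc.diff v hv).cexp⟩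

theorem Good.pow {c : ℂ × ℝ → ℂ} (hc : Good ε V c) (n : ℕ) : Good ε V fun p => c p ^ n :=
  ⟨hc.cont.pow n, fun v hv => (hc.diff v hv).pow n⟩

theorem Good.sum {ι : Type*} (s : Finset ι) {c : ι → ℂ × ℝ → ℂ}
    (hc : ∀ i ∈ s, Good ε V (c i)) : Good ε V fun p => ∑ i ∈ s, c i p :=
  ⟨continuousOn_finsetSum _ fun i hi => (hc i hi).cont,
    fun v hv => DifferentiableOn.fun_sum fun i hi => (hc i hi).diff v hv⟩

theorem Good.tsum {c : ℕ → ℂ × ℝ → ℂ} (hc : ∀ i, Good ε V (c i)) {u : ℕ → ℝ} (hu : Summable u)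
    (h : ∀ i, ∀ p ∈ box ε V, ‖c i p‖ ≤ u i) : Good ε V fun p => ∑' i, c i p :=
  ⟨continuousOn_tsum (fun i => (hc i).cont) hu h, fun v hv =>
    Complex.differentiableOn_tsum_of_summable_norm hu (fun i => (hc i).diff v hv) Metric.isOpen_ball
      fun i _ hg => h i _ (mk_mem_box hg hv)⟩

theorem Good.exists_bound {c : ℂ × ℝ → ℂ} (hc : Good ε V c) :
    ∃ B, 0 ≤ B ∧ ∀ p ∈ box ε V, ‖c p‖ ≤ B := by
  obtain ⟨B, hB⟩ := (isCompact_box ε V).exists_bound_of_continuousOn hc.cont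
  exact ⟨|B|, abs_nonneg _, fun p hp => (hB p hp).trans (le_abs_self _)⟩

/-- `F n p = O(n ^ k)` uniformly in the parameters. -/
def IsBigOPow (ε V : ℝ) (k : ℤ) (F : ℕ → ℂ × ℝ → ℂ) : Prop :=
  ∃ B : ℝ, 0 ≤ B ∧ ∀ n : ℕ, 1 ≤ n → ∀ p ∈ box ε V, ‖F n p‖ ≤ B * (n : ℝ) ^ k

theorem IsBigOPow.mono {k l : ℤ} {F : ℕ → ℂ × ℝ → ℂ} (h : IsBigOPow ε V k F) (hkl : k ≤ l) :
    IsBigOPow ε V l F := by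
  obtain ⟨B, hB, h⟩ := h
  refine ⟨B, hB, fun n hn p hp => (h n hn p hp).trans ?_⟩
  have : (1 : ℝ) ≤ n := by exact_mod_cast hn
  gcongr

theorem IsBigOPow.congr {k : ℤ} {F G : ℕ → ℂ × ℝ → ℂ} (h : IsBigOPow ε V k F)
    (hFG : ∀ n, 1 ≤ n → ∀ p ∈ box ε V, F n p = G n p) : IsBigOPow ε V k G := by
  obtain ⟨B, hB, h⟩ := h
  exact ⟨B, hB, fun n hn p hp => by rw [← hFG n hn p hp]; exact h n hn p hp⟩

theorem IsBigOPow.add {k : ℤ} {F G : ℕ → ℂ × ℝ → ℂ} (hF : IsBigOPow ε V k F)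
    (hG : IsBigOPow ε V k G) : IsBigOPow ε V k fun n p => F n p + G n p := by
  obtain ⟨B, hB, hF⟩ := hF
  obtain ⟨B', hB', hG⟩ := hG
  refine ⟨B + B', by positivity, fun n hn p hp => (norm_add_le _ _).trans ?_⟩
  rw [add_mul]
  exact add_le_add (hF n hn p hp) (hG n hn p hp)

theorem IsBigOPow.neg {k : ℤ} {F : ℕ → ℂ × ℝ → ℂ} (hF : IsBigOPow ε V k F) :
    IsBigOPow ε V k fun n p => -F n p := by
  simpa only [IsBigOPow, norm_neg] using hF

theorem IsBigOPow.mul {k l : ℤ} {F G : ℕ → ℂ × ℝ → ℂ} (hF : IsBigOPow ε V k F)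
    (hG : IsBigOPow ε V l G) : IsBigOPow ε V (k + l) fun n p => F n p * G n p := by
  obtain ⟨B, hB, hF⟩ := hF
  obtain ⟨B', hB', hG⟩ := hG
  refine ⟨B * B', by positivity, fun n hn p hp => ?_⟩
  have hn0 : (n : ℝ) ≠ 0 := by positivity
  have hn1 : (0 : ℝ) ≤ (n : ℝ) ^ k := by positivity
  rw [norm_mul, zpow_add₀ hn0, mul_mul_mul_comm]
  exact mul_le_mul (hF n hn p hp) (hG n hn p hp) (norm_nonneg _) (by positivity)

theorem isBigOPow_zero (k : ℤ) : IsBigOPow ε V k fun _ _ => 0 :=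
  ⟨0, le_rfl, fun n _ p _ => by simp⟩

theorem Good.isBigOPow {c : ℂ × ℝ → ℂ} (hc : Good ε V c) : IsBigOPow ε V 0 fun _ p => c p := by
  obtain ⟨B, hB, h⟩ := hc.exists_bound
  exact ⟨B, hB, fun n _ p hp => by simpa using h p hp⟩

theorem IsBigOPow.sum {ι : Type*} (s : Finset ι) {k : ℤ} {F : ι → ℕ → ℂ × ℝ → ℂ}
    (hF : ∀ i ∈ s, IsBigOPow ε V k (F i)) : IsBigOPow ε V k fun n p => ∑ i ∈ s, F i n p := by
  classical
  induction s using Finset.induction_on with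
  | empty => simpa using isBigOPow_zero k
  | insert i s hi ih =>
    simp only [Finset.sum_insert hi]
    exact (hF i (Finset.mem_insert_self _ _)).add
      (ih fun j hj => hF j (Finset.mem_insert_of_mem hj))

theorem isBigOPow_binomRem {α : ℂ × ℝ → ℂ} (hα : Good ε V α) {t : ℕ → ℂ × ℝ → ℝ} {T : ℝ}
    (ht : ∀ n, 1 ≤ n → ∀ p ∈ box ε V, 0 ≤ t n p ∧ t n p ≤ T / n) (J : ℕ) :
    IsBigOPow ε V (-J) fun n p => binomRem (α p) J (t n p) := by
  obtain ⟨A, hA, hαA⟩ := hα.exists_bound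
  refine ⟨(A + J) ^ J * (1 + |T|) ^ (A + J) * |T| ^ J, by positivity, fun n hn p hp => ?_⟩
  obtain ⟨h0, h1⟩ := ht n hn p hp
  have hn' : (1 : ℝ) ≤ n := by exact_mod_cast hn
  have h2 : t n p ≤ |T| / n := h1.trans (by gcongr; exact le_abs_self T)
  have h3 : t n p ≤ |T| := h2.trans (div_le_self (abs_nonneg _) hn')
  refine (norm_binomRem_le J (α p) h0 h3).trans ?_
  have h4 := hαA p hp
  have h5 : (1 : ℝ) ≤ 1 + |T| := by linarith [abs_nonneg T]
  calc (‖α p‖ + J) ^ J * (1 + |T|) ^ (‖α p‖ + J) * t n p ^ J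
      ≤ (A + J) ^ J * (1 + |T|) ^ (A + J) * (|T| / n) ^ J := by gcongr
    _ = _ := by rw [div_pow, zpow_neg, zpow_natCast]; ring

/-- `n ^ s` for `n ≥ 1`. -/
def natPow (n : ℕ) (s : ℂ) : ℂ := Complex.exp (s * (Real.log n : ℝ))

theorem natPow_add (n : ℕ) (s t : ℂ) : natPow n (s + t) = natPow n s * natPow n t := by
  rw [natPow, add_mul, Complex.exp_add]; rfl

theorem natPow_eq_cpow {n : ℕ} (hn : 1 ≤ n) (s : ℂ) : natPow n s = (n : ℂ) ^ s := by
  rw [Complex.cpow_def_of_ne_zero (by exact_mod_cast (by omega : n ≠ 0)), natPow,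
    Complex.ofReal_log (by positivity), mul_comm]
  simp

theorem natPow_neg_natCast {n : ℕ} (hn : 1 ≤ n) (i : ℕ) :
    natPow n (-i) = ((1 / n : ℝ) : ℂ) ^ i := by
  rw [natPow_eq_cpow hn, Complex.cpow_neg, Complex.cpow_natCast]
  push_cast
  rw [one_div, inv_pow]

theorem norm_natPow_le {n : ℕ} (hn : 1 ≤ n) {s : ℂ} {k : ℤ} (h : s.re ≤ k) :
    ‖natPow n s‖ ≤ (n : ℝ) ^ k := by
  have hn' : (1 : ℝ) ≤ n := by exact_mod_cast hn
  rw [natPow, Complex.norm_exp, Complex.re_mul_ofReal, ← Real.rpow_intCast,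
    Real.rpow_def_of_pos (by positivity), mul_comm]
  have := Real.log_nonneg hn'
  gcongr

/-- The factor `g` in front of negative powers of `n`. -/
def polePre (q : ℤ) (g : ℂ) : ℂ := if q < 0 then g else 1

theorem polePre_of_neg {q : ℤ} (h : q < 0) (g : ℂ) : polePre q g = g := if_pos h

theorem polePre_of_nonneg {q : ℤ} (h : 0 ≤ q) (g : ℂ) : polePre q g = 1 := if_neg (by omega)

theorem good_polePre (q : ℤ) : Good ε V fun p => polePre q p.1 := by
  by_cases h : q < 0
  · simpa only [polePre_of_neg h] using Good.fst
  · simpa only [polePre_of_nonneg (not_lt.1 h)] using Good.const 1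

theorem good_exponent (q : ℤ) (R : ℕ) : Good ε V fun p => (q : ℂ) - R * p.1 :=
  (Good.const _).sub ((Good.const _).mul Good.fst)

/-- If `q + r < 0` then `q` or `r` is negative and supplies the required factor `g`; a superfluous
one goes into `G`. -/
theorem exists_polePre_mul (q r : ℤ) :
    ∃ G, Good ε V G ∧ ∀ p : ℂ × ℝ, polePre q p.1 * polePre r p.1 = polePre (q + r) p.1 * G p := by
  by_cases h : q + r < 0
  · by_cases hq : q < 0
    · exact ⟨_, good_polePre r, fun p => by rw [polePre_of_neg h, polePre_of_neg hq]⟩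
    · refine ⟨_, Good.const 1, fun p => ?_⟩
      rw [polePre_of_neg h, polePre_of_nonneg (not_lt.1 hq), polePre_of_neg (by omega)]
      ring
  · exact ⟨_, (good_polePre q).mul (good_polePre r), fun p => by
      rw [polePre_of_nonneg (not_lt.1 h), one_mul]⟩

/-- When the exponent `q - i` passes from `0` to `-1`, the new factor of the falling factorial is
`-R g`: this is where the factor `g` of negative powers originates. -/
theorem exists_polePre_mul_fallFact (q : ℤ) (R i : ℕ) :
    ∃ G, Good ε V G ∧ ∀ p : ℂ × ℝ,
      polePre q p.1 * fallFact (q - R * p.1) i = polePre (q - i) p.1 * G p := by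
  induction i with
  | zero => exact ⟨_, Good.const 1, fun p => by simp [fallFact]⟩
  | succ i ih =>
    obtain ⟨G, hG, h⟩ := ih
    have hG' : Good ε V fun p => G p * ((q : ℂ) - R * p.1 - i) :=
      hG.mul ((good_exponent q R).sub (Good.const _))
    rcases lt_trichotomy (q - i) 0 with h0 | h0 | h0
    · refine ⟨_, hG', fun p => ?_⟩
      rw [fallFact_succ, ← mul_assoc, h, polePre_of_neg h0, polePre_of_neg (by push_cast; omega)]
      ring
    · refine ⟨_, hG.mul (Good.const (-R)), fun p => ?_⟩
      have hq : (q : ℂ) - i = 0 := by exact_mod_cast h0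
      rw [fallFact_succ, ← mul_assoc, h, polePre_of_nonneg h0.ge,
        polePre_of_neg (by push_cast; omega)]
      linear_combination G p * hq
    · refine ⟨_, hG', fun p => ?_⟩
      rw [fallFact_succ, ← mul_assoc, h, polePre_of_nonneg h0.le,
        polePre_of_nonneg (by push_cast; omega)]
      ring

/-- An elementary term `d(g, v) n ^ (q - R g)`, with an extra factor `g` if `q < 0`. -/
def elemTerm (q : ℤ) (R : ℕ) (d : ℂ × ℝ → ℂ) (n : ℕ) (p : ℂ × ℝ) : ℂ :=
  polePre q p.1 * d p * natPow n (q - R * p.1)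

/-- Finite sums of elementary terms with `1 ≤ R ≤ m`. -/
def expansions (ε V : ℝ) (m : ℕ) : AddSubgroup (ℕ → ℂ × ℝ → ℂ) :=
  AddSubgroup.closure {F | ∃ (q : ℤ) (R : ℕ) (d : ℂ × ℝ → ℂ),
    1 ≤ R ∧ R ≤ m ∧ Good ε V d ∧ F = elemTerm q R d}

theorem elemTerm_mem {m : ℕ} (q : ℤ) {R : ℕ} {d : ℂ × ℝ → ℂ} (h1 : 1 ≤ R) (h2 : R ≤ m)
    (hd : Good ε V d) : elemTerm q R d ∈ expansions ε V m :=
  AddSubgroup.subset_closure ⟨q, R, d, h1, h2, hd, rfl⟩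

theorem expansions_mono {m m' : ℕ} (h : m ≤ m') : expansions ε V m ≤ expansions ε V m' := by
  refine AddSubgroup.closure_mono ?_
  rintro F ⟨q, R, d, h1, h2, h3, h4⟩
  exact ⟨q, R, d, h1, h2.trans h, h3, h4⟩

theorem mul_mem_expansions {m m' : ℕ} {F G : ℕ → ℂ × ℝ → ℂ} (hF : F ∈ expansions ε V m)
    (hG : G ∈ expansions ε V m') : F * G ∈ expansions ε V (m + m') := by
  induction hF using AddSubgroup.closure_induction with
  | zero => rw [zero_mul]; exact zero_mem _
  | add F F' _ _ h h' => rw [add_mul]; exact add_mem h h'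
  | neg F _ h => rw [neg_mul]; exact neg_mem h
  | mem F hF =>
    obtain ⟨q, R, d, h1, h2, h3, rfl⟩ := hF
    induction hG using AddSubgroup.closure_induction with
    | zero => rw [mul_zero]; exact zero_mem _
    | add G G' _ _ h h' => rw [mul_add]; exact add_mem h h'
    | neg G _ h => rw [mul_neg]; exact neg_mem h
    | mem G hG =>
      obtain ⟨q', R', d', h1', h2', h3', rfl⟩ := hG
      obtain ⟨P, hP, hPe⟩ := exists_polePre_mul (ε := ε) (V := V) q q'
      have : elemTerm q R d * elemTerm q' R' d' =
          elemTerm (q + q') (R + R') (fun p => P p * (d p * d' p)) := by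
        funext n p
        have e : ((q + q' : ℤ) : ℂ) - ((R + R' : ℕ) : ℂ) * p.1 =
            ((q : ℂ) - R * p.1) + ((q' : ℂ) - R' * p.1) := by
          push_cast
          ring
        simp only [Pi.mul_apply, elemTerm]
        rw [e, natPow_add]
        linear_combination d p * d' p * natPow n ((q : ℂ) - R * p.1) *
          natPow n ((q' : ℂ) - R' * p.1) * hPe p
      rw [this]
      exact elemTerm_mem _ (by omega) (by omega) (hP.mul (h3.mul h3'))

theorem good_mul_mem_expansions {m : ℕ} {F : ℕ → ℂ × ℝ → ℂ} {c : ℂ × ℝ → ℂ} (hc : Good ε V c)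
    (hF : F ∈ expansions ε V m) : (fun n p => F n p * c p) ∈ expansions ε V m := by
  change F * (fun _ p => c p) ∈ _
  induction hF using AddSubgroup.closure_induction with
  | zero => rw [zero_mul]; exact zero_mem _
  | add F F' _ _ h h' => rw [add_mul]; exact add_mem h h'
  | neg F _ h => rw [neg_mul]; exact neg_mem h
  | mem F hF =>
    obtain ⟨q, R, d, h1, h2, h3, rfl⟩ := hF
    have : elemTerm q R d * (fun _ p => c p) = elemTerm q R fun p => d p * c p := by
      funext n p
      simp only [Pi.mul_apply, elemTerm]
      ring
    rw [this]
    exact elemTerm_mem _ h1 h2 (h3.mul hc)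

theorem good_natPow (n : ℕ) (q : ℤ) (R : ℕ) : Good ε V fun p => natPow n (q - R * p.1) :=
  ((good_exponent q R).mul (Good.const _)).exp

theorem good_of_mem_expansions {m : ℕ} {F : ℕ → ℂ × ℝ → ℂ} (hF : F ∈ expansions ε V m) (n : ℕ) :
    Good ε V (F n) := by
  induction hF using AddSubgroup.closure_induction with
  | zero => exact Good.const 0
  | add F F' _ _ h h' => exact h.add h'
  | neg F _ h => exact h.neg
  | mem F hF =>
    obtain ⟨q, R, d, h1, h2, h3, rfl⟩ := hF
    exact ((good_polePre q).mul h3).mul (good_natPow n q R)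

/-- One extra power of `n` absorbs `n ^ (-R g)`, since `‖R g‖ < 1` on the box. -/
theorem isBigOPow_natPow {m R : ℕ} (hm : m * ε < 1) (hR : R ≤ m) (q : ℤ) :
    IsBigOPow ε V (q + 1) fun n p => natPow n (q - R * p.1) := by
  refine ⟨1, zero_le_one, fun n hn p hp => ?_⟩
  rw [one_mul]
  refine norm_natPow_le hn ?_
  have h1 := norm_fst_le_of_mem_box hp
  have h2 : -((R : ℂ) * p.1).re ≤ 1 := by
    have h3 := Complex.abs_re_le_norm ((R : ℂ) * p.1)
    rw [norm_mul, Complex.norm_natCast] at h3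
    have h4 : (R : ℝ) * ‖p.1‖ ≤ m * ε := by gcongr
    linarith [neg_le_abs ((R : ℂ) * p.1).re]
  rw [Complex.sub_re, Complex.intCast_re]
  push_cast
  linarith

theorem isBigOPow_elemTerm {m R : ℕ} (hm : m * ε < 1) (hR : R ≤ m) (q : ℤ) {d : ℂ × ℝ → ℂ}
    (hd : Good ε V d) : IsBigOPow ε V (q + 1) (elemTerm q R d) := by
  have := ((good_polePre q).mul hd).isBigOPow.mul (isBigOPow_natPow hm hR q)
  rwa [zero_add] at this

theorem exists_isBigOPow {m : ℕ} (hm : m * ε < 1) {F : ℕ → ℂ × ℝ → ℂ}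
    (hF : F ∈ expansions ε V m) : ∃ k : ℕ, IsBigOPow ε V k F := by
  induction hF using AddSubgroup.closure_induction with
  | zero => exact ⟨0, isBigOPow_zero _⟩
  | add F F' _ _ h h' =>
    obtain ⟨k, h⟩ := h
    obtain ⟨k', h'⟩ := h'
    exact ⟨k + k', (h.mono (by push_cast; omega)).add (h'.mono (by push_cast; omega))⟩
  | neg F _ h => exact ⟨_, h.choose_spec.neg⟩
  | mem F hF =>
    obtain ⟨q, R, d, h1, h2, h3, rfl⟩ := hF
    exact ⟨(q + 1).toNat, (isBigOPow_elemTerm hm h2 q h3).mono (by omega)⟩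

end Box

/-! ### Summation of expansions and the induction on depth. -/

section Summation

variable {ε V : ℝ}

theorem one_le_div_bound {n : ℕ} : (0 : ℝ) ≤ 1 / n ∧ (1 : ℝ) / n ≤ 1 / n := ⟨by positivity, le_rfl⟩

theorem natPow_succ {n : ℕ} (hn : 1 ≤ n) (s : ℂ) (J : ℕ) :
    natPow (n + 1) s = natPow n s * (binomRem s J (1 / n) +
      ∑ i ∈ Finset.range J, fallFact s i / (i.factorial : ℂ) * ((1 / n : ℝ) : ℂ) ^ i) := by
  have hn' : (0 : ℝ) < n := by exact_mod_cast hn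
  have h : Real.log ((n + 1 : ℕ) : ℝ) = Real.log n + Real.log (1 + 1 / n) := by
    rw [← Real.log_mul (by positivity) (by positivity)]
    congr 1
    push_cast
    field_simp
  rw [binomRem, sub_add_cancel, natPow, natPow, h, ← Complex.exp_add]
  congr 1
  push_cast
  ring

/-- As `‖R g‖ < 1`, the divisor `q + 1 - R g` can vanish only for `q = -1`. In that case it equals
`-R g` and cancels the factor `g`, while the new exponent `q + 1 = 0` no longer requires one. -/
theorem exists_polePre_div {m R : ℕ} (hm : m * ε < 1) (h1 : 1 ≤ R) (h2 : R ≤ m) (q : ℤ)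
    {d : ℂ × ℝ → ℂ} (hd : Good ε V d) : ∃ d', Good ε V d' ∧ ∀ p ∈ box ε V,
      polePre (q + 1) p.1 * d' p * ((q : ℂ) - R * p.1 + 1) = polePre q p.1 * d p := by
  by_cases hq : q = -1
  · subst hq
    have hR : (R : ℂ) ≠ 0 := by exact_mod_cast (by omega : R ≠ 0)
    refine ⟨_, hd.mul (Good.const (-(R : ℂ)⁻¹)), fun p _ => ?_⟩
    rw [polePre_of_nonneg (by norm_num), polePre_of_neg (by norm_num)]
    push_cast
    field_simp
    ring
  · have hne : ∀ p ∈ box ε V, (q : ℂ) - R * p.1 + 1 ≠ 0 := by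
      intro p hp h0
      have h3 := norm_fst_le_of_mem_box hp
      have h4 : ((q + 1 : ℤ) : ℂ) = R * p.1 := by
        push_cast
        linear_combination h0
      have h5 := congrArg norm h4
      rw [Complex.norm_intCast, norm_mul, Complex.norm_natCast] at h5
      have h6 : (1 : ℝ) ≤ |((q + 1 : ℤ) : ℝ)| := by
        exact_mod_cast Int.one_le_abs (by omega : q + 1 ≠ 0)
      have h7 : (R : ℝ) * ‖p.1‖ ≤ m * ε := by gcongr
      linarith
    refine ⟨_, hd.mul (((good_exponent q R).add (Good.const 1)).inv hne), fun p hp => ?_⟩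
    have := hne p hp
    have hpre : polePre (q + 1) p.1 = polePre q p.1 := by
      by_cases h : q < 0
      · rw [polePre_of_neg h, polePre_of_neg (by omega)]
      · rw [polePre_of_nonneg (by omega), polePre_of_nonneg (by omega)]
    rw [hpre]
    field_simp

/-- A discrete primitive: with `s = q - R g`, the difference of `n ^ (s + 1) / (s + 1)` is `n ^ s`
plus terms with smaller `q`, which are summed in turn. The recursion stops once the term itself is
`O(n ^ (-K))`; `j` bounds the number of steps left. -/
theorem exists_sum_elemTerm {m : ℕ} (hm : m * ε < 1) (K : ℕ) (j : ℕ) : ∀ (q : ℤ) (R : ℕ)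
    (d : ℂ × ℝ → ℂ), q + K + 1 < j → 1 ≤ R → R ≤ m → Good ε V d →
    ∃ F ∈ expansions ε V m,
      IsBigOPow ε V (-K) fun n p => elemTerm q R d n p - (F (n + 1) p - F n p) := by
  induction j with
  | zero =>
    intro q R d hq h1 h2 hd
    refine ⟨0, zero_mem _, ?_⟩
    simpa using (isBigOPow_elemTerm hm h2 q hd).mono (l := -K) (by push_cast at hq; omega)
  | succ j ih =>
    intro q R d hq h1 h2 hd
    obtain ⟨d', hd', hdd'⟩ := exists_polePre_div hm h1 h2 q hd
    -- The primitive is `O(n ^ (q + 2))`, and `J + 2` terms of the binomial expansion of `(1 + 1 /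
    -- n) ^ (s + 1)` leave a relative error `O(n ^ (-(J + 2)))`.
    obtain ⟨J, hJ⟩ : ∃ J : ℕ, q + 1 + 1 + -((J + 1 + 1 : ℕ) : ℤ) ≤ -K :=
      ⟨(q + K).toNat, by push_cast; omega⟩
    choose G hG hGe using fun i => exists_polePre_mul_fallFact (ε := ε) (V := V) q R i
    let e : ℕ → ℂ × ℝ → ℂ := fun i p => d p * G i p * ((i + 1).factorial : ℂ)⁻¹
    have he : ∀ i, Good ε V (e i) := fun i => (hd.mul (hG i)).mul (Good.const _)
    have hH : ∀ i ∈ Finset.range J, ∃ F ∈ expansions ε V m, IsBigOPow ε V (-K) fun n p =>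
        elemTerm (q - (i + 1 : ℕ)) R (e (i + 1)) n p - (F (n + 1) p - F n p) := fun i _ =>
      ih _ R _ (by push_cast at hq ⊢; omega) h1 h2 (he _)
    choose! H hHm hHe using hH
    refine ⟨elemTerm (q + 1) R d' - ∑ i ∈ Finset.range J, H i,
      sub_mem (elemTerm_mem _ h1 h2 hd') (sum_mem hHm), ?_⟩
    have hrem := (isBigOPow_elemTerm hm h2 (q + 1) hd').mul
      (isBigOPow_binomRem (T := 1) (good_exponent (ε := ε) (V := V) (q + 1) R)
        (fun n _ p _ => one_le_div_bound (n := n)) (J + 1 + 1))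
    refine ((IsBigOPow.sum _ hHe).add (hrem.mono hJ)).neg.congr fun n hn p hp => ?_
    have hs : (((q + 1 : ℤ) : ℂ) - R * p.1) = (q : ℂ) - R * p.1 + 1 := by
      push_cast
      ring
    set s : ℂ := (q : ℂ) - R * p.1 with hsdef
    have hterm : ∀ i, elemTerm (q - (i : ℕ)) R (e i) n p =
        polePre q p.1 * d p * natPow n s * (fallFact s i / ((i + 1).factorial : ℂ) *
          ((1 / n : ℝ) : ℂ) ^ i) := by
      intro i
      have e1 : ((q - (i : ℕ) : ℤ) : ℂ) - R * p.1 = s + -(i : ℂ) := by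
        rw [hsdef]; push_cast; ring
      rw [elemTerm, e1, natPow_add, natPow_neg_natCast hn]
      simp only [e]
      linear_combination (-(d p * ((i + 1).factorial : ℂ)⁻¹ * natPow n s *
        ((1 / n : ℝ) : ℂ) ^ i)) * hGe i p
    have h0 : elemTerm q R d n p = polePre q p.1 * d p * natPow n s := rfl
    have h1' : elemTerm (q + 1) R d' n p = polePre (q + 1) p.1 * d' p * natPow n (s + 1) := by
      rw [elemTerm, hs]
    have h2' : elemTerm (q + 1) R d' (n + 1) p =
        polePre (q + 1) p.1 * d' p * natPow (n + 1) (s + 1) := by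
      rw [elemTerm, hs]
    have h3 : natPow n (s + 1) * ((1 / n : ℝ) : ℂ) = natPow n s := by
      have := natPow_neg_natCast hn 1
      rw [pow_one] at this
      rw [← this, ← natPow_add]
      congr 1
      push_cast
      ring
    have hkey : polePre (q + 1) p.1 * d' p * natPow n (s + 1) *
        ∑ i ∈ Finset.range (J + 1), fallFact (s + 1) (i + 1) / ((i + 1).factorial : ℂ) *
          ((1 / n : ℝ) : ℂ) ^ (i + 1) =
        ∑ i ∈ Finset.range J, elemTerm (q - (i + 1 : ℕ)) R (e (i + 1)) n p +
          elemTerm q R d n p := by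
      have : elemTerm q R d n p = elemTerm (q - (0 : ℕ)) R (e 0) n p := by
        rw [hterm 0, h0]
        simp [fallFact]
      rw [this, ← Finset.sum_range_succ' (fun i => elemTerm (q - (i : ℕ)) R (e i) n p) J,
        Finset.mul_sum]
      refine Finset.sum_congr rfl fun i _ => ?_
      rw [hterm i, fallFact_succ', add_sub_cancel_right, ← hdd' p hp, ← h3, pow_succ]
      ring
    simp only [Pi.sub_apply, Finset.sum_apply, Finset.sum_sub_distrib]
    rw [h2', natPow_succ hn (s + 1) (J + 1 + 1), Finset.sum_range_succ', h1', hs]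
    simp only [fallFact, Finset.range_zero, Finset.prod_empty, Nat.factorial_zero, Nat.cast_one,
      div_one, pow_zero, mul_one]
    simp only [fallFact] at hkey
    linear_combination hkey

theorem exists_sum_expansion {m : ℕ} (hm : m * ε < 1) (K : ℕ) {E : ℕ → ℂ × ℝ → ℂ}
    (hE : E ∈ expansions ε V m) : ∃ F ∈ expansions ε V m,
      IsBigOPow ε V (-K) fun n p => E n p - (F (n + 1) p - F n p) := by
  induction hE using AddSubgroup.closure_induction with
  | zero => exact ⟨0, zero_mem _, by simpa using isBigOPow_zero (-K)⟩
  | add E E' _ _ h h' =>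
    obtain ⟨F, hF, h⟩ := h
    obtain ⟨F', hF', h'⟩ := h'
    refine ⟨F + F', add_mem hF hF', (h.add h').congr fun n _ p _ => ?_⟩
    simp only [Pi.add_apply]
    ring
  | neg E _ h =>
    obtain ⟨F, hF, h⟩ := h
    refine ⟨-F, neg_mem hF, h.neg.congr fun n _ p _ => ?_⟩
    simp only [Pi.neg_apply]
    ring
  | mem E hE =>
    obtain ⟨q, R, d, h1, h2, h3, rfl⟩ := hE
    exact exists_sum_elemTerm hm K ((q + K + 2).toNat) q R d (by omega) h1 h2 h3

/-- The value at `n` of the letter `(A, r)`, that is `(n + v) ^ (A - r g)`. -/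
def letterVal (x : ℕ × ℕ) (n : ℕ) (p : ℂ × ℝ) : ℂ :=
  Complex.exp (((x.1 : ℂ) - x.2 * p.1) * (Real.log (n + p.2) : ℝ))

/-- `F` has an expansion in powers of `n` up to `O(n ^ (-K))`. -/
def HasExpansion (ε V : ℝ) (m K : ℕ) (F : ℕ → ℂ × ℝ → ℂ) : Prop :=
  ∃ E ∈ expansions ε V m, IsBigOPow ε V (-K) fun n p => F n p - E n p

theorem hasExpansion_letterVal {m : ℕ} (hm : m * ε < 1) {x : ℕ × ℕ} (h1 : 1 ≤ x.2)
    (h2 : x.2 ≤ m) (K : ℕ) : HasExpansion ε V m K (letterVal x) := by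
  obtain ⟨A, r⟩ := x
  dsimp only at h1 h2
  choose G hG hGe using fun i => exists_polePre_mul_fallFact (ε := ε) (V := V) A r i
  let e : ℕ → ℂ × ℝ → ℂ := fun i p => G i p * ((p.2 : ℂ) ^ i * ((i.factorial : ℕ) : ℂ)⁻¹)
  have he : ∀ i, Good ε V (e i) := fun i => (hG i).mul ((Good.snd.pow i).mul (Good.const _))
  -- The power `n ^ (A - r g)` is `O(n ^ (A + 1))`, so `A + 1 + K` terms in `v / n` reach precision
  -- `n ^ (-K)`.
  refine ⟨∑ i ∈ Finset.range (A + 1 + K), elemTerm (A - (i : ℕ)) r (e i),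
    sum_mem fun i _ => elemTerm_mem _ h1 h2 (he i), ?_⟩
  have ht : ∀ n : ℕ, 1 ≤ n → ∀ p ∈ box ε V, 0 ≤ p.2 / n ∧ p.2 / n ≤ V / n := by
    intro n hn p hp
    have h3 : 0 ≤ p.2 := hp.2.1
    have h4 : p.2 ≤ V := hp.2.2
    constructor
    · positivity
    · gcongr
  have hrem := (isBigOPow_natPow (V := V) hm h2 A).mul
    (isBigOPow_binomRem (good_exponent A r) ht (A + 1 + K))
  refine (hrem.mono (l := -K) (by push_cast; omega)).congr fun n hn p hp => ?_
  have hn' : (0 : ℝ) < n := by exact_mod_cast hn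
  have hv : 0 ≤ p.2 := hp.2.1
  simp only [Int.cast_natCast]
  set s : ℂ := (A : ℂ) - r * p.1 with hs
  have hlog : Real.log (n + p.2) = Real.log n + Real.log (1 + p.2 / n) := by
    rw [← Real.log_mul (by positivity) (by positivity)]
    congr 1
    field_simp
  have hterm : ∀ i, elemTerm (A - (i : ℕ)) r (e i) n p =
      natPow n s * (fallFact s i / (i.factorial : ℂ) * ((p.2 / n : ℝ) : ℂ) ^ i) := by
    intro i
    have e1 : ((A - (i : ℕ) : ℤ) : ℂ) - r * p.1 = s + -(i : ℂ) := by
      rw [hs]; push_cast; ring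
    have e2 := hGe i p
    rw [polePre_of_nonneg (Int.natCast_nonneg A), one_mul, Int.cast_natCast, ← hs] at e2
    rw [elemTerm, e1, natPow_add, natPow_neg_natCast hn, e2]
    simp only [e]
    rw [div_eq_mul_one_div p.2, Complex.ofReal_mul, mul_pow]
    ring
  have hval : letterVal (A, r) n p = natPow n s * (binomRem s (A + 1 + K) (p.2 / n) +
      ∑ i ∈ Finset.range (A + 1 + K), fallFact s i / (i.factorial : ℂ) *
        ((p.2 / n : ℝ) : ℂ) ^ i) := by
    rw [binomRem, sub_add_cancel, letterVal, natPow, ← Complex.exp_add, hlog]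
    congr 1
    push_cast
    ring
  simp only [Finset.sum_apply, hterm, hval, ← Finset.mul_sum]
  ring

theorem good_letterVal (x : ℕ × ℕ) {n : ℕ} (hn : 1 ≤ n) : Good ε V (letterVal x n) := by
  refine Good.exp (((Good.const _).sub ((Good.const _).mul Good.fst)).mul ⟨?_, fun v _ =>
    differentiableOn_const ((Real.log (n + v) : ℝ) : ℂ)⟩)
  refine Complex.continuous_ofReal.comp_continuousOn (ContinuousOn.log (by fun_prop) ?_)
  intro p hp
  have h1 : (1 : ℝ) ≤ n := by exact_mod_cast hn
  have h2 : 0 ≤ p.2 := hp.2.1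
  positivity

/-- The nested sum of the letters `(n + v) ^ (A - r g)`, as a function of the parameters. -/
def letterSum : List (ℕ × ℕ) → ℕ → ℂ × ℝ → ℂ
  | [], _, _ => 1
  | x :: l, M, p => ∑ n ∈ Finset.Ico 1 M, letterVal x n p * letterSum l n p

theorem good_letterSum (l : List (ℕ × ℕ)) : ∀ n, Good ε V (letterSum l n) := by
  induction l with
  | nil => exact fun _ => Good.const 1
  | cons x l ih =>
    intro M
    exact Good.sum _ fun n hn => (good_letterVal x (Finset.mem_Ico.1 hn).1).mul (ih n)

theorem HasExpansion.exists_isBigOPow {m K : ℕ} (hm : m * ε < 1) {F : ℕ → ℂ × ℝ → ℂ}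
    (h : HasExpansion ε V m K F) : ∃ k : ℕ, IsBigOPow ε V k F := by
  obtain ⟨E, hE, h⟩ := h
  obtain ⟨k, hk⟩ := RenZeta.exists_isBigOPow hm hE
  refine ⟨k, ((h.mono (l := k) (by omega)).add hk).congr fun n _ p _ => ?_⟩
  ring

/-- The precision needed for `G` depends only on the growth of `F` and on `K`, hence is fixed before
`G`; the precision used for `F` is then adapted to the growth of the expansion of `G`. The constant
`c` is kept apart because `expansions` admits no `R = 0`; multiplied by the expansion of `F` it
becomes admissible. -/
theorem exists_hasExpansion_mul {r : ℕ} (hr : r * ε < 1) {F : ℕ → ℂ × ℝ → ℂ}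
    (hF : ∀ K, HasExpansion ε V r K F) (K : ℕ) :
    ∃ k : ℕ, ∀ (m : ℕ) (G : ℕ → ℂ × ℝ → ℂ) (c : ℂ × ℝ → ℂ), m * ε < 1 → Good ε V c →
      HasExpansion ε V m k (fun n p => G n p - c p) →
      HasExpansion ε V (r + m) K fun n p => F n p * G n p := by
  obtain ⟨k, hk⟩ := (hF 0).exists_isBigOPow hr
  refine ⟨K + k, fun m G c hm hc ⟨E, hE, hGE⟩ => ?_⟩
  obtain ⟨k', hk'⟩ := RenZeta.exists_isBigOPow hm hE
  obtain ⟨E', hE', hFE⟩ := hF (K + k')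
  refine ⟨E' * E + fun n p => E' n p * c p, add_mem (mul_mem_expansions hE' hE)
    (expansions_mono (by omega) (good_mul_mem_expansions hc hE')), ?_⟩
  have h1 := (hk.mul hGE).mono (l := -K) (by push_cast; omega)
  have h2 := (hFE.mul (hk'.add (hc.isBigOPow.mono (l := k') (by omega)))).mono (l := -K)
    (by push_cast; omega)
  refine (h1.add h2).congr fun n _ p _ => ?_
  simp only [Pi.add_apply, Pi.mul_apply]
  ring

/-- Of the `K + 2` powers, two make the series converge uniformly, so its sum is again good, and the
other `K` bound the tail from `M` on. -/
theorem exists_sum_of_isBigOPow {K : ℕ} {e : ℕ → ℂ × ℝ → ℂ}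
    (he : ∀ n, 1 ≤ n → Good ε V (e n)) (hK : IsBigOPow ε V (-(K + 2 : ℕ)) e) :
    ∃ C, Good ε V C ∧
      IsBigOPow ε V (-K) fun M p => ∑ n ∈ Finset.Ico 1 M, e n p - C p := by
  obtain ⟨B, hB, hb⟩ := hK
  have hu : Summable fun n : ℕ => B * (1 / ((n + 1 : ℕ) : ℝ) ^ 2) :=
    ((summable_nat_add_iff 1).2 (Real.summable_one_div_nat_pow.2 one_lt_two)).mul_left B
  have hle : ∀ n M : ℕ, 1 ≤ M → M ≤ n → ∀ p ∈ box ε V,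
      ‖e n p‖ ≤ (M : ℝ) ^ (-K : ℤ) * (B * (1 / (n : ℝ) ^ 2)) := by
    intro n M hM hMn p hp
    refine (hb n (hM.trans hMn) p hp).trans (le_of_le_of_eq (b := B * ((1 / (n : ℝ) ^ 2) *
      (M : ℝ) ^ (-K : ℤ))) ?_ (by ring))
    have hM' : (0 : ℝ) < M := by exact_mod_cast hM
    have hMn' : (M : ℝ) ≤ n := by exact_mod_cast hMn
    have hn' : (0 : ℝ) < n := hM'.trans_le hMn'
    rw [zpow_neg, zpow_neg, zpow_natCast, zpow_natCast, pow_add, mul_inv, one_div,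
      mul_comm ((n : ℝ) ^ K)⁻¹]
    gcongr
  have hterm : ∀ n : ℕ, ∀ p ∈ box ε V, ‖e (n + 1) p‖ ≤ B * (1 / ((n + 1 : ℕ) : ℝ) ^ 2) := by
    intro n p hp
    have := hle (n + 1) 1 le_rfl (by omega) p hp
    simpa using this
  refine ⟨fun p => ∑' n, e (n + 1) p, Good.tsum (fun n => he _ (by omega)) hu hterm, ?_⟩
  refine ⟨∑' n : ℕ, B * (1 / ((n + 1 : ℕ) : ℝ) ^ 2), tsum_nonneg fun n => by positivity,
    fun M hM p hp => ?_⟩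
  have hs : Summable fun n => e (n + 1) p := hu.of_norm_bounded fun n => hterm n p hp
  have hsplit := hs.sum_add_tsum_nat_add (M - 1)
  have hIco : ∑ n ∈ Finset.Ico 1 M, e n p = ∑ n ∈ Finset.range (M - 1), e (n + 1) p := by
    rw [Finset.sum_Ico_eq_sum_range]
    exact Finset.sum_congr rfl fun n _ => by rw [add_comm]
  beta_reduce
  rw [hIco, ← hsplit, sub_add_cancel_left, norm_neg, mul_comm, ← tsum_mul_left]
  have hu' : Summable fun n : ℕ => B * (1 / ((n + (M - 1) + 1 : ℕ) : ℝ) ^ 2) :=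
    (summable_nat_add_iff (f := fun n : ℕ => B * (1 / ((n + 1 : ℕ) : ℝ) ^ 2)) (M - 1)).2 hu
  have h1 := tsum_of_norm_bounded (hu'.mul_left ((M : ℝ) ^ (-K : ℤ))).hasSum
    (f := fun n => e (n + (M - 1) + 1) p) (fun n => hle (n + (M - 1) + 1) M hM (by omega) p hp)
  have h2 : ∀ n : ℕ, (M : ℝ) ^ (-K : ℤ) * (B * (1 / ((n + (M - 1) + 1 : ℕ) : ℝ) ^ 2)) ≤
      (M : ℝ) ^ (-K : ℤ) * (B * (1 / ((n + 1 : ℕ) : ℝ) ^ 2)) := by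
    intro n
    have h3 : ((n + 1 : ℕ) : ℝ) ≤ ((n + (M - 1) + 1 : ℕ) : ℝ) := by
      exact_mod_cast (by omega : n + 1 ≤ n + (M - 1) + 1)
    have h4 : (0 : ℝ) < ((n + 1 : ℕ) : ℝ) := by positivity
    gcongr
  exact h1.trans ((hu'.mul_left _).tsum_le_tsum h2 (hu.mul_left _))

theorem sum_Ico_one_sub {M : ℕ} (hM : 1 ≤ M) (f : ℕ → ℂ) :
    ∑ n ∈ Finset.Ico 1 M, (f (n + 1) - f n) = f M - f 1 :=
  Finset.sum_Ico_sub f hM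

/-- The total multiplicity of `-g` in the exponents of a list of letters. -/
def totalMult (l : List (ℕ × ℕ)) : ℕ := (l.map Prod.snd).sum

theorem totalMult_cons (x : ℕ × ℕ) (l : List (ℕ × ℕ)) :
    totalMult (x :: l) = x.2 + totalMult l := by
  simp [totalMult]

/-- The summand has no constant term, since its first letter brings `R ≥ 1`; summing creates the
constant `C`. The second clause records this for the summand, which is the change of the sum when
the cut-off moves by one. -/
theorem exists_letterSum_and_mul_expansion (l : List (ℕ × ℕ)) (hl : ∀ x ∈ l, 1 ≤ x.2)
    (hε : 0 ≤ ε) (hm : totalMult l * ε < 1) :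
    (∀ K, ∃ C, Good ε V C ∧
      HasExpansion ε V (totalMult l) K fun n p => letterSum l n p - C p) ∧
    (∀ x l', l = x :: l' → ∀ K,
      HasExpansion ε V (totalMult l) K fun n p => letterVal x n p * letterSum l' n p) := by
  induction l with
  | nil =>
    refine ⟨fun K => ⟨_, Good.const 1, 0, zero_mem _, ?_⟩, by simp⟩
    simpa [letterSum] using isBigOPow_zero (-K)
  | cons x l ih =>
    rw [List.forall_mem_cons] at hl
    rw [totalMult_cons] at hm ⊢
    rw [Nat.cast_add, add_mul] at hm
    have h0 : 0 ≤ (totalMult l : ℝ) * ε := by positivity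
    have h0' : 0 ≤ (x.2 : ℝ) * ε := by positivity
    have hx : (x.2 : ℝ) * ε < 1 := by linarith
    have hml : (totalMult l : ℝ) * ε < 1 := by linarith
    have hprod : ∀ K, HasExpansion ε V (x.2 + totalMult l) K
        fun n p => letterVal x n p * letterSum l n p := by
      intro K
      obtain ⟨k, hk⟩ := exists_hasExpansion_mul hx
        (fun K => hasExpansion_letterVal (V := V) hx hl.1 le_rfl K) K
      obtain ⟨C, hC, hG⟩ := (ih hl.2 hml).1 k
      exact hk _ _ C hml hC hG
    refine ⟨fun K => ?_, ?_⟩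
    · obtain ⟨E, hE, hEe⟩ := hprod (K + 2)
      obtain ⟨F, hF, hFe⟩ := exists_sum_expansion
        (by push_cast; linarith) (K + 2) hE
      have he : IsBigOPow ε V (-(K + 2 : ℕ))
          fun n p => letterVal x n p * letterSum l n p - (F (n + 1) p - F n p) :=
        (hEe.add hFe).congr fun n _ p _ => by ring
      obtain ⟨C, hC, hCe⟩ := exists_sum_of_isBigOPow (fun n hn =>
        ((good_letterVal x hn).mul (good_letterSum l n)).sub
          ((good_of_mem_expansions hF (n + 1)).sub (good_of_mem_expansions hF n))) he
      -- Telescoping from `1` leaves `F M - F 1`, and `F 1` joins the constant.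
      refine ⟨_, hC.sub (good_of_mem_expansions hF 1), F, hF, hCe.congr fun M hM p _ => ?_⟩
      have : letterSum (x :: l) M p =
          ∑ n ∈ Finset.Ico 1 M, letterVal x n p * letterSum l n p := rfl
      beta_reduce
      rw [Finset.sum_sub_distrib, sum_Ico_one_sub hM (fun n => F n p), this]
      ring
    · rintro x' l' h K
      obtain ⟨rfl, rfl⟩ := List.cons_eq_cons.1 h
      exact hprod K

end Summation

/-! ### Finite parts of nested sums as holomorphic functions of `g`. -/

section FinitePart

variable {ε V : ℝ}

theorem Good.continuousOn_slice {c : ℂ × ℝ → ℂ} (hc : Good ε V c) {g : ℂ} (hg : ‖g‖ ≤ ε) :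
    ContinuousOn (fun u => c (g, u)) (Icc 0 V) :=
  hc.cont.comp (by fun_prop) fun u hu => ⟨by simpa using hg, hu⟩

theorem Good.intervalIntegrable {c : ℂ × ℝ → ℂ} (hc : Good ε V c) {g : ℂ} (hg : ‖g‖ ≤ ε) {v : ℝ}
    (hv : v ∈ Icc 0 V) : IntervalIntegrable (fun u => c (g, u)) MeasureTheory.volume 0 v := by
  refine ((hc.continuousOn_slice hg).mono ?_).intervalIntegrable
  rw [uIcc_of_le hv.1]
  exact Icc_subset_Icc_right hv.2

/-- Here `0 < ‖R g‖ < 1`, so the exponent is never zero and the power contributes no constant term.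
-/
theorem isFinitePart_natPow {m R : ℕ} (hm : m * ε < 1) (h1 : 1 ≤ R) (h2 : R ≤ m) (q : ℤ) {g : ℂ}
    (hg : ‖g‖ ≤ ε) (hg0 : g ≠ 0) : IsFinitePart (fun N => natPow N (q - R * g)) 0 := by
  have hR : 0 < (R : ℝ) * ‖g‖ := by
    have : (0 : ℝ) < R := by exact_mod_cast h1
    have := norm_pos_iff.2 hg0
    positivity
  have hne : (q : ℂ) - R * g ≠ 0 := by
    intro h
    have h3 := congrArg norm (sub_eq_zero.1 h)
    rw [Complex.norm_intCast, norm_mul, Complex.norm_natCast] at h3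
    have h4 : (R : ℝ) * ‖g‖ ≤ m * ε := by gcongr
    have h5 : |(q : ℝ)| < 1 := by linarith
    have h6 : |q| < 1 := by exact_mod_cast h5
    rw [Int.abs_lt_one_iff] at h6
    rw [h6, Int.cast_zero, abs_zero] at h3
    linarith
  refine (isFinitePart_cpow hne).congr ?_
  filter_upwards [eventually_ge_atTop 1] with N hN
  rw [natPow_eq_cpow hN]

theorem isFinitePart_const_zero : IsFinitePart (fun _ => 0) 0 :=
  isFinitePart_of_tendsto tendsto_const_nhds

/-- The powers of `N` do not involve `v`, so integrating over `v` only changes the coefficients. -/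
theorem isFinitePart_integral_expansion {m : ℕ} (hm : m * ε < 1) {E : ℕ → ℂ × ℝ → ℂ}
    (hE : E ∈ expansions ε V m) {g : ℂ} (hg : ‖g‖ ≤ ε) (hg0 : g ≠ 0) {v : ℝ} (hv : v ∈ Icc 0 V) :
    IsFinitePart (fun N => E N (g, v)) 0 ∧
      IsFinitePart (fun N => ∫ u in (0 : ℝ)..v, E N (g, u)) 0 := by
  induction hE using AddSubgroup.closure_induction with
  | zero => simpa using isFinitePart_const_zero
  | add E E' hE hE' h h' =>
    refine ⟨by simpa using h.1.add h'.1, ?_⟩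
    have := h.2.add h'.2
    rw [add_zero] at this
    refine this.congr (Eventually.of_forall fun N => ?_)
    simp only [Pi.add_apply]
    rw [intervalIntegral.integral_add
      ((good_of_mem_expansions hE N).intervalIntegrable hg hv)
      ((good_of_mem_expansions hE' N).intervalIntegrable hg hv)]
  | neg E _ h =>
    refine ⟨by simpa using h.1.const_mul (-1), ?_⟩
    simpa using h.2.const_mul (-1)
  | mem E hE =>
    obtain ⟨q, R, d, h1, h2, -, rfl⟩ := hE
    have h := isFinitePart_natPow hm h1 h2 q hg hg0
    constructor
    · simpa only [mul_zero, elemTerm] using h.const_mul (polePre q g * d (g, v))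
    · have := h.const_mul (∫ u in (0 : ℝ)..v, polePre q g * d (g, u))
      simpa only [mul_zero, elemTerm, intervalIntegral.integral_mul_const] using this

theorem HasExpansion.isFinitePart {m : ℕ} (hm : m * ε < 1) {F : ℕ → ℂ × ℝ → ℂ}
    (hF : HasExpansion ε V m 1 F) {g : ℂ} (hg : ‖g‖ ≤ ε) (hg0 : g ≠ 0) {v : ℝ}
    (hv : v ∈ Icc 0 V) : IsFinitePart (fun N => F N (g, v)) 0 := by
  obtain ⟨E, hE, B, hB, h⟩ := hF
  have h1 : Tendsto (fun N => F N (g, v) - E N (g, v)) atTop (𝓝 0) := by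
    refine squeeze_zero_norm' (a := fun N : ℕ => B * (N : ℝ)⁻¹) ?_ ?_
    · filter_upwards [eventually_ge_atTop 1] with N hN
      simpa using h N hN (g, v) ⟨by simpa using hg, hv⟩
    · simpa using tendsto_inv_atTop_nhds_zero_nat.const_mul B
  have := (isFinitePart_integral_expansion hm hE hg hg0 hv).1.add (isFinitePart_of_tendsto h1)
  simpa using this

theorem HasExpansion.isFinitePart_integral {m : ℕ} (hm : m * ε < 1) {F : ℕ → ℂ × ℝ → ℂ}
    (hF : HasExpansion ε V m 1 F) (hgood : ∀ n, Good ε V (F n)) {g : ℂ} (hg : ‖g‖ ≤ ε)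
    (hg0 : g ≠ 0) {v : ℝ} (hv : v ∈ Icc 0 V) :
    IsFinitePart (fun N => ∫ u in (0 : ℝ)..v, F N (g, u)) 0 := by
  obtain ⟨E, hE, B, hB, h⟩ := hF
  have h1 : Tendsto (fun N => ∫ u in (0 : ℝ)..v, (F N (g, u) - E N (g, u))) atTop (𝓝 0) := by
    refine squeeze_zero_norm' (a := fun N : ℕ => B * (N : ℝ)⁻¹ * |v - 0|) ?_ ?_
    · filter_upwards [eventually_ge_atTop 1] with N hN
      refine intervalIntegral.norm_integral_le_of_norm_le_const fun u hu => ?_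
      rw [uIoc_of_le hv.1] at hu
      simpa using h N hN (g, u) ⟨by simpa using hg, hu.1.le, hu.2.trans hv.2⟩
    · simpa using (tendsto_inv_atTop_nhds_zero_nat.const_mul B).mul_const |v - 0|
  have := (isFinitePart_integral_expansion hm hE hg hg0 hv).2.add (isFinitePart_of_tendsto h1)
  rw [add_zero] at this
  refine this.congr (Eventually.of_forall fun N => ?_)
  rw [intervalIntegral.integral_sub ((hgood N).intervalIntegrable hg hv)
    ((good_of_mem_expansions hE N).intervalIntegrable hg hv)]
  ring

/-- The finite part of nested sums, with its holomorphic extension to `g = 0`. -/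
structure IsFamily (ε V : ℝ) (l : List (ℕ × ℕ)) (C : ℂ × ℝ → ℂ) : Prop where
  good : Good ε V C
  fp : ∀ g : ℂ, ‖g‖ ≤ ε → g ≠ 0 → ∀ v ∈ Icc 0 V,
    IsFinitePart (fun N => letterSum l N (g, v)) (C (g, v))
  fp_succ : ∀ g : ℂ, ‖g‖ ≤ ε → g ≠ 0 → ∀ v ∈ Icc 0 V,
    IsFinitePart (fun N => letterSum l (N + 1) (g, v)) (C (g, v))
  fp_integral : ∀ g : ℂ, ‖g‖ ≤ ε → g ≠ 0 → ∀ v ∈ Icc 0 V,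
    IsFinitePart (fun N => ∫ u in (0 : ℝ)..v, letterSum l N (g, u)) (∫ u in (0 : ℝ)..v, C (g, u))

/-- Sums over `n < N` and over `n ≤ N` are both needed: the shift identity relates one to the other.
They differ by the last summand, whose finite part is zero. -/
theorem exists_isFamily (V : ℝ) (hε : 0 ≤ ε) (l : List (ℕ × ℕ)) (hl : ∀ x ∈ l, 1 ≤ x.2)
    (hm : totalMult l * ε < 1) : ∃ C, IsFamily ε V l C := by
  obtain ⟨h1, h2⟩ := exists_letterSum_and_mul_expansion (V := V) l hl hε hm
  obtain ⟨C, hC, hE⟩ := h1 1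
  have hfp : ∀ g : ℂ, ‖g‖ ≤ ε → g ≠ 0 → ∀ v ∈ Icc 0 V,
      IsFinitePart (fun N => letterSum l N (g, v)) (C (g, v)) := by
    intro g hg hg0 v hv
    simpa using (hE.isFinitePart hm hg hg0 hv).add
      (isFinitePart_of_tendsto (tendsto_const_nhds (x := C (g, v))))
  refine ⟨C, hC, hfp, fun g hg hg0 v hv => ?_, fun g hg hg0 v hv => ?_⟩
  · cases l with
    | nil => exact hfp g hg hg0 v hv
    | cons x l =>
      have := (hfp g hg hg0 v hv).add ((h2 x l rfl 1).isFinitePart hm hg hg0 hv)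
      rw [add_zero] at this
      refine this.congr ?_
      filter_upwards [eventually_ge_atTop 1] with N hN
      exact (Finset.sum_Ico_succ_top hN _).symm
  · have := (hE.isFinitePart_integral hm (fun n => (good_letterSum l n).sub hC) hg hg0 hv).add
      (isFinitePart_of_tendsto (tendsto_const_nhds (x := ∫ u in (0 : ℝ)..v, C (g, u))))
    rw [zero_add] at this
    refine this.congr (Eventually.of_forall fun N => ?_)
    rw [intervalIntegral.integral_sub ((good_letterSum l N).intervalIntegrable hg hv)
      (hC.intervalIntegrable hg hv), sub_add_cancel]

/-- A radius that is admissible for a given total multiplicity. -/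
theorem exists_radius (m : ℕ) : ∃ ε : ℝ, 0 < ε ∧ m * ε < 1 := by
  refine ⟨1 / (m + 1), by positivity, ?_⟩
  rw [mul_one_div, div_lt_one (by positivity)]
  linarith

/-- The cut-off nested sum of the letters `(n + v) ^ (A - r g)`. -/
def letterCutoff (l : List (ℕ × ℕ)) (g : ℂ) (v : ℝ) : ℂ :=
  finitePart fun N => letterSum l (N + 1) (g, v)

/-- The limit at `g = 0` of the cut-off nested sum. -/
def renLetter (l : List (ℕ × ℕ)) (v : ℝ) : ℂ :=
  limUnder (𝓝[≠] (0 : ℂ)) fun g => letterCutoff l g v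

namespace IsFamily

variable {l : List (ℕ × ℕ)} {C : ℂ × ℝ → ℂ}

theorem analyticAt (h : IsFamily ε V l C) (hε : 0 < ε) {v : ℝ} (hv : v ∈ Icc 0 V) :
    AnalyticAt ℂ (fun g => C (g, v)) 0 :=
  (h.good.diff v hv).analyticAt (Metric.ball_mem_nhds 0 hε)

theorem letterCutoff_eq (h : IsFamily ε V l C) {g : ℂ} (hg : ‖g‖ ≤ ε) (hg0 : g ≠ 0) {v : ℝ}
    (hv : v ∈ Icc 0 V) : letterCutoff l g v = C (g, v) :=
  (h.fp_succ g hg hg0 v hv).finitePart_eq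

theorem eventually_letterCutoff_eq (h : IsFamily ε V l C) (hε : 0 < ε) {v : ℝ}
    (hv : v ∈ Icc 0 V) : ∀ᶠ g in 𝓝[≠] (0 : ℂ), letterCutoff l g v = C (g, v) := by
  filter_upwards [self_mem_nhdsWithin, nhdsWithin_le_nhds (Metric.closedBall_mem_nhds 0 hε)]
    with g hg0 hg
  exact h.letterCutoff_eq (by simpa using hg) hg0 hv

theorem renLetter_eq (h : IsFamily ε V l C) (hε : 0 < ε) {v : ℝ} (hv : v ∈ Icc 0 V) :
    renLetter l v = C (0, v) := by
  refine Tendsto.limUnder_eq (Tendsto.congr' ?_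
    ((h.analyticAt hε hv).continuousAt.tendsto.mono_left nhdsWithin_le_nhds))
  filter_upwards [h.eventually_letterCutoff_eq hε hv] with g hg
  exact hg.symm

end IsFamily

theorem tendsto_letterCutoff {l : List (ℕ × ℕ)} (hl : ∀ x ∈ l, 1 ≤ x.2) {v : ℝ} (hv : 0 ≤ v) :
    Tendsto (fun g => letterCutoff l g v) (𝓝[≠] (0 : ℂ)) (𝓝 (renLetter l v)) := by
  obtain ⟨ε, hε, hm⟩ := exists_radius (totalMult l)
  obtain ⟨C, hC⟩ := exists_isFamily v hε.le l hl hm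
  have hv' : v ∈ Icc 0 v := ⟨hv, le_rfl⟩
  rw [hC.renLetter_eq hε hv']
  refine Tendsto.congr' ?_
    ((hC.analyticAt hε hv').continuousAt.tendsto.mono_left nhdsWithin_le_nhds)
  filter_upwards [hC.eventually_letterCutoff_eq hε hv'] with g hg
  exact hg.symm

theorem exists_analyticAt_letterCutoff {l : List (ℕ × ℕ)} (hl : ∀ x ∈ l, 1 ≤ x.2) {v : ℝ}
    (hv : 0 ≤ v) : ∃ H : ℂ → ℂ, AnalyticAt ℂ H 0 ∧ H 0 = renLetter l v ∧
      ∀ᶠ g in 𝓝[≠] (0 : ℂ), letterCutoff l g v = H g := by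
  obtain ⟨ε, hε, hm⟩ := exists_radius (totalMult l)
  obtain ⟨C, hC⟩ := exists_isFamily v hε.le l hl hm
  have hv' : v ∈ Icc 0 v := ⟨hv, le_rfl⟩
  exact ⟨_, hC.analyticAt hε hv', (hC.renLetter_eq hε hv').symm,
    hC.eventually_letterCutoff_eq hε hv'⟩

theorem continuousOn_renLetter {l : List (ℕ × ℕ)} (hl : ∀ x ∈ l, 1 ≤ x.2) :
    ContinuousOn (renLetter l) (Ici 0) := by
  intro v hv
  have hv0 : (0 : ℝ) ≤ v := hv
  obtain ⟨ε, hε, hm⟩ := exists_radius (totalMult l)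
  obtain ⟨C, hC⟩ := exists_isFamily (v + 1) hε.le l hl hm
  have h1 : ContinuousOn (renLetter l) (Icc 0 (v + 1)) :=
    (hC.good.continuousOn_slice (by simpa using hε.le)).congr fun u hu => hC.renLetter_eq hε hu
  refine (h1 v ⟨hv0, by linarith⟩).mono_of_mem_nhdsWithin ?_
  filter_upwards [self_mem_nhdsWithin, nhdsWithin_le_nhds (Iic_mem_nhds (lt_add_one v))]
    with u hu hu'
  exact ⟨hu, hu'⟩

end FinitePart

/-! ### The shift `v ↦ v + 1` for nested sums of letters. -/

section Shift

theorem conv_sum_left {Λ ι : Type*} (s : Finset ι) (F : ι → List Λ → ℂ) (G : List Λ → ℂ)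
    (l : List Λ) : conv (fun l => ∑ i ∈ s, F i l) G l = ∑ i ∈ s, conv (F i) G l := by
  classical
  induction s using Finset.induction_on with
  | empty => simpa using conv_smul_left 0 (fun _ => 0) G l
  | insert i s hi ih =>
    simp only [Finset.sum_insert hi]
    rw [conv_add_left, ih]

theorem letterVal_add_one (x : ℕ × ℕ) (n : ℕ) (g : ℂ) (v : ℝ) :
    letterVal x (n + 1) (g, v) = letterVal x n (g, v + 1) := by
  simp only [letterVal]
  rw [show ((n + 1 : ℕ) : ℝ) + v = n + (v + 1) by push_cast; ring]

theorem letterSum_one (l : List (ℕ × ℕ)) (p : ℂ × ℝ) :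
    letterSum l 1 p = if l = [] then 1 else 0 := by
  cases l <;> simp [letterSum]

/-- Splitting off the terms with the smallest summation index equal to `1`. -/
theorem letterSum_succ_eq_conv (g : ℂ) (v : ℝ) (l : List (ℕ × ℕ)) : ∀ M : ℕ, 1 ≤ M →
    letterSum l (M + 1) (g, v) = conv (fun l => letterSum l M (g, v + 1))
      (weighted (fun x => letterVal x 1 (g, v)) fun n => if n ≤ 1 then 1 else 0) l := by
  induction l with
  | nil => intro M _; rw [conv_weighted_nil]; rfl
  | cons x l ih =>
    intro M hM
    have h1 : letterSum (x :: l) (M + 1) (g, v) =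
        ∑ n ∈ Finset.Ico 1 (M + 1), letterVal x n (g, v) * letterSum l n (g, v) := rfl
    have h2 : (fun l' => letterSum (x :: l') M (g, v + 1)) = fun l' =>
        ∑ n ∈ Finset.Ico 1 M, letterVal x n (g, v + 1) * letterSum l' n (g, v + 1) := rfl
    rw [h1, Finset.sum_eq_sum_Ico_succ_bot (by omega), conv, h2, conv_sum_left]
    congr 1
    · rw [letterSum_one]
      cases l <;> simp [weighted, letterSum]
    · rw [← Finset.sum_Ico_add' _ 1 M 1]
      refine Finset.sum_congr rfl fun n hn => ?_
      rw [conv_smul_left, ih n (Finset.mem_Ico.1 hn).1, letterVal_add_one]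

/-- The identity holds for finite cut-offs; uniqueness of finite parts gives it for small `g ≠ 0`,
and then `g → 0` turns the value of a letter at `n = 1` into `(v + 1) ^ A`. -/
theorem renLetter_shift {v : ℝ} (hv : 0 ≤ v) {l : List (ℕ × ℕ)} (hl : ∀ x ∈ l, 1 ≤ x.2) :
    renLetter l v = conv (fun l => renLetter l (v + 1))
      (weighted (fun x => ((v : ℂ) + 1) ^ x.1) fun n => if n ≤ 1 then 1 else 0) l := by
  obtain ⟨ε, hε, hm⟩ := exists_radius (totalMult l)
  have hv1 : v ∈ Icc 0 (v + 1) := ⟨hv, by linarith⟩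
  have hv2 : v + 1 ∈ Icc 0 (v + 1) := ⟨by linarith, le_rfl⟩
  have hnhds : ∀ᶠ g in 𝓝[≠] (0 : ℂ), ‖g‖ ≤ ε ∧ g ≠ 0 := by
    filter_upwards [self_mem_nhdsWithin, nhdsWithin_le_nhds (Metric.closedBall_mem_nhds 0 hε)]
      with g hg0 hg
    exact ⟨by simpa using hg, hg0⟩
  obtain ⟨C, hC⟩ := exists_isFamily (v + 1) hε.le l hl hm
  rcases List.eq_nil_or_concat' l with rfl | ⟨l, x, rfl⟩
  · rw [conv_weighted_nil]
    refine tendsto_nhds_unique (tendsto_letterCutoff hl hv)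
      ((tendsto_letterCutoff hl (by linarith)).congr fun g => rfl)
  · have hl' : ∀ x ∈ l, 1 ≤ x.2 := fun y hy => hl y (by simp [hy])
    have hm' : totalMult l * ε < 1 := by
      refine lt_of_le_of_lt ?_ hm
      gcongr
      simp [totalMult]
    obtain ⟨D, hD⟩ := exists_isFamily (v + 1) hε.le l hl' hm'
    rw [conv_weighted_append]
    refine tendsto_nhds_unique (tendsto_letterCutoff hl hv) (Tendsto.congr' ?_
      ((tendsto_letterCutoff hl (v := v + 1) (by linarith)).add
        (Tendsto.mul (f := fun g => letterVal x 1 (g, v)) ?_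
          (tendsto_letterCutoff hl' (v := v + 1) (by linarith)))))
    · filter_upwards [hnhds] with g hg
      rw [hC.letterCutoff_eq hg.1 hg.2 hv1, hC.letterCutoff_eq hg.1 hg.2 hv2,
        hD.letterCutoff_eq hg.1 hg.2 hv2]
      refine IsFinitePart.unique ?_ (hC.fp_succ g hg.1 hg.2 v hv1)
      refine ((hC.fp g hg.1 hg.2 _ hv2).add
        ((hD.fp g hg.1 hg.2 _ hv2).const_mul (letterVal x 1 (g, v)))).congr ?_
      filter_upwards [eventually_ge_atTop 1] with N hN
      rw [letterSum_succ_eq_conv g v _ N hN, conv_weighted_append]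
    · have h1 : ContinuousAt (fun g : ℂ => letterVal x 1 (g, v)) 0 := by
        unfold letterVal
        dsimp only
        generalize ((Real.log (((1 : ℕ) : ℝ) + v) : ℝ) : ℂ) = a
        fun_prop
      have h2 : letterVal x 1 (0, v) = ((v : ℂ) + 1) ^ x.1 := by
        have h3 : (0 : ℝ) < 1 + v := by linarith
        rw [letterVal, mul_zero, sub_zero, Complex.exp_nat_mul, Nat.cast_one,
          ← Complex.ofReal_exp, Real.exp_log h3, add_comm]
        push_cast
        rfl
      rw [← h2]
      exact h1.tendsto.mono_left nhdsWithin_le_nhds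

end Shift

/-! ### The derivative in `v` for nested sums of letters. -/

section Derivative

/-- Lowering the exponent of a letter. -/
def lowerLetter (x : ℕ × ℕ) : ℕ × ℕ := (x.1 - 1, x.2)

/-- The exponent of a letter. -/
def letterExp (g : ℂ) (x : ℕ × ℕ) : ℂ := (x.1 : ℂ) - x.2 * g

theorem lowerSum_sum {Λ ι : Type*} (wt : Λ → ℂ) (dn : Λ → Λ) (s : Finset ι) (a : ι → ℂ)
    (F : ι → List Λ → ℂ) (l : List Λ) :
    lowerSum wt dn (fun l => ∑ i ∈ s, a i * F i l) l = ∑ i ∈ s, a i * lowerSum wt dn (F i) l := by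
  simp only [lowerSum, smul_eq_mul, Finset.mul_sum]
  rw [Finset.sum_comm]
  exact Finset.sum_congr rfl fun i _ => Finset.sum_congr rfl fun j _ => by ring

theorem hasDerivAt_letterVal {x : ℕ × ℕ} (hx : 1 ≤ x.1) {n : ℕ} (hn : 1 ≤ n) (g : ℂ) {v : ℝ}
    (hv : 0 ≤ v) : HasDerivAt (fun v => letterVal x n (g, v))
      (letterExp g x * letterVal (lowerLetter x) n (g, v)) v := by
  have hn' : (0 : ℝ) < n := by exact_mod_cast hn
  refine (hasDerivAt_exp_log (a := n) (t := v) (by positivity) (letterExp g x)).congr_deriv ?_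
  simp only [letterVal, lowerLetter, letterExp]
  rw [Nat.cast_sub hx, Nat.cast_one, sub_right_comm]

theorem hasDerivAt_letterSum (l : List (ℕ × ℕ)) (hl : ∀ x ∈ l, 1 ≤ x.1) (g : ℂ) {v : ℝ}
    (hv : 0 ≤ v) : ∀ M : ℕ, HasDerivAt (fun v => letterSum l M (g, v))
      (lowerSum (letterExp g) lowerLetter (fun l => letterSum l M (g, v)) l) v := by
  induction l with
  | nil =>
    intro M
    rw [lowerSum_nil]
    exact hasDerivAt_const v (1 : ℂ)
  | cons x l ih =>
    intro M
    rw [List.forall_mem_cons] at hl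
    have h : HasDerivAt (fun v => ∑ n ∈ Finset.Ico 1 M, letterVal x n (g, v) * letterSum l n (g, v))
        (∑ n ∈ Finset.Ico 1 M,
          (letterExp g x * letterVal (lowerLetter x) n (g, v) * letterSum l n (g, v) +
          letterVal x n (g, v) * lowerSum (letterExp g) lowerLetter
            (fun l => letterSum l n (g, v)) l)) v :=
      HasDerivAt.fun_sum fun n hn =>
        (hasDerivAt_letterVal hl.1 (Finset.mem_Ico.1 hn).1 g hv).mul (ih hl.2 n)
    refine h.congr_deriv ?_
    have h2 : (fun l' => letterSum (x :: l') M (g, v)) = fun l' =>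
        ∑ n ∈ Finset.Ico 1 M, letterVal x n (g, v) * letterSum l' n (g, v) := rfl
    rw [lowerSum_cons, h2, lowerSum_sum, Finset.sum_add_distrib]
    congr 1
    rw [letterSum, smul_eq_mul, Finset.mul_sum]
    exact Finset.sum_congr rfl fun n _ => by ring

theorem totalMult_set_lowerLetter (l : List (ℕ × ℕ)) (j : ℕ) (hj : j < l.length) :
    totalMult (l.set j (lowerLetter l[j])) = totalMult l := by
  induction l generalizing j with
  | nil => simp at hj
  | cons x l ih =>
    cases j with
    | zero => simp [totalMult, lowerLetter]
    | succ j =>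
      simp only [List.set_cons_succ, List.getElem_cons_succ, totalMult_cons]
      rw [ih j (by simpa using hj)]

theorem one_le_snd_set_lowerLetter {l : List (ℕ × ℕ)} (hl : ∀ x ∈ l, 1 ≤ x.2) (j : ℕ)
    (hj : j < l.length) : ∀ x ∈ l.set j (lowerLetter l[j]), 1 ≤ x.2 := by
  intro x hx
  rcases List.mem_or_eq_of_mem_set hx with h | rfl
  · exact hl x h
  · change 1 ≤ l[j].2
    exact hl _ (List.getElem_mem hj)

/-- An asymptotic expansion may be integrated in a parameter, but not differentiated without further
control. Hence the derivative formula for finite sums is integrated from `0` to `v` before taking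
finite parts; the limit `g → 0` passes under the integral by the uniform bounds on the box. -/
theorem renLetter_sub_eq_integral {l : List (ℕ × ℕ)} (hl1 : ∀ x ∈ l, 1 ≤ x.1)
    (hl : ∀ x ∈ l, 1 ≤ x.2) {v : ℝ} (hv : 0 ≤ v) :
    renLetter l v - renLetter l 0 =
      lowerSum (letterExp 0) lowerLetter (fun l => ∫ u in (0 : ℝ)..v, renLetter l u) l := by
  obtain ⟨ε, hε, hm⟩ := exists_radius (totalMult l)
  have hv0 : (0 : ℝ) ∈ Icc 0 v := ⟨le_rfl, hv⟩
  have hv1 : v ∈ Icc 0 v := ⟨hv, le_rfl⟩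
  obtain ⟨C, hC⟩ := exists_isFamily v hε.le l hl hm
  have hD : ∀ j : Fin l.length, ∃ D, IsFamily ε v (l.set j (lowerLetter l[j])) D := fun j =>
    exists_isFamily v hε.le _ (one_le_snd_set_lowerLetter hl j j.2)
      (by rw [Fin.getElem_fin, totalMult_set_lowerLetter l j j.2]; exact hm)
  choose D hD using hD
  have hfin : ∀ g : ℂ, ‖g‖ ≤ ε → g ≠ 0 → C (g, v) - C (g, 0) =
      ∑ j : Fin l.length, letterExp g l[j] * ∫ u in (0 : ℝ)..v, D j (g, u) := by
    intro g hg hg0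
    have hint : ∀ N, ∀ j : Fin l.length, IntervalIntegrable
        (fun u => letterSum (l.set j (lowerLetter l[j])) N (g, u)) MeasureTheory.volume 0 v :=
      fun N j => (good_letterSum _ N).intervalIntegrable (ε := ε) hg hv1
    have hFTC : ∀ N, letterSum l N (g, v) - letterSum l N (g, 0) = ∑ j : Fin l.length,
        letterExp g l[j] * ∫ u in (0 : ℝ)..v,
          letterSum (l.set j (lowerLetter l[j])) N (g, u) := by
      intro N
      have h1 := intervalIntegral.integral_eq_sub_of_hasDerivAt (a := 0) (b := v)
        (f := fun v => letterSum l N (g, v))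
        (fun u hu => hasDerivAt_letterSum l hl1 g (by rw [uIcc_of_le hv] at hu; exact hu.1) N)
        (by
          simp only [lowerSum, smul_eq_mul]
          refine (IntervalIntegrable.sum Finset.univ fun j _ =>
            (hint N j).const_mul (letterExp g l[j])).congr fun u _ => ?_
          simp only [Finset.sum_apply])
      rw [← h1]
      simp only [lowerSum, smul_eq_mul]
      rw [intervalIntegral.integral_finsetSum fun j _ => (hint N j).const_mul _]
      simp only [intervalIntegral.integral_const_mul]
    have h1 := (hC.fp g hg hg0 v hv1).sub (hC.fp g hg hg0 0 hv0)
    have h2 : IsFinitePart (fun N => ∑ j : Fin l.length, letterExp g l[j] *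
        ∫ u in (0 : ℝ)..v, letterSum (l.set j (lowerLetter l[j])) N (g, u))
        (∑ j : Fin l.length, letterExp g l[j] * ∫ u in (0 : ℝ)..v, D j (g, u)) :=
      isFinitePart_sum Finset.univ fun j _ =>
        ((hD j).fp_integral g hg hg0 v hv1).const_mul (letterExp g l[j])
    simp only [hFTC] at h1
    exact h1.unique h2
  have hball : Metric.closedBall (0 : ℂ) ε ∈ 𝓝 (0 : ℂ) := Metric.closedBall_mem_nhds 0 hε
  have hlim : Tendsto (fun g : ℂ => ∑ j : Fin l.length, letterExp g l[j] *
      ∫ u in (0 : ℝ)..v, D j (g, u)) (𝓝[≠] 0)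
      (𝓝 (∑ j : Fin l.length, letterExp 0 l[j] * ∫ u in (0 : ℝ)..v, D j (0, u))) := by
    refine tendsto_finsetSum _ fun j _ => Tendsto.mul ?_ ?_
    · have : Continuous fun g : ℂ => letterExp g l[j] := by
        unfold letterExp
        fun_prop
      exact (this.tendsto 0).mono_left nhdsWithin_le_nhds
    · refine Tendsto.mono_left ?_ nhdsWithin_le_nhds
      obtain ⟨B, hB, hb⟩ := (hD j).good.exists_bound
      refine intervalIntegral.tendsto_integral_filter_of_dominated_convergence (fun _ => B)
        ?_ ?_ intervalIntegrable_const ?_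
      · filter_upwards [hball] with g hg
        exact (IntervalIntegrable.def' ((hD j).good.intervalIntegrable
          (by simpa using hg) hv1)).aestronglyMeasurable
      · filter_upwards [hball] with g hg
        refine Eventually.of_forall fun u hu => hb _ ⟨hg, ?_⟩
        rw [uIoc_of_le hv] at hu
        exact ⟨hu.1.le, hu.2⟩
      · refine Eventually.of_forall fun u hu => ?_
        rw [uIoc_of_le hv] at hu
        exact ((hD j).analyticAt hε ⟨hu.1.le, hu.2⟩).continuousAt.tendsto
  have hlim' : Tendsto (fun g : ℂ => C (g, v) - C (g, 0)) (𝓝[≠] 0) (𝓝 (C (0, v) - C (0, 0))) :=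
    (((hC.analyticAt hε hv1).continuousAt.tendsto).sub
      ((hC.analyticAt hε hv0).continuousAt.tendsto)).mono_left nhdsWithin_le_nhds
  rw [hC.renLetter_eq hε hv1, hC.renLetter_eq hε hv0,
    tendsto_nhds_unique (hlim'.congr' ?_) hlim]
  · simp only [lowerSum, smul_eq_mul]
    refine Finset.sum_congr rfl fun j _ => ?_
    congr 1
    refine intervalIntegral.integral_congr fun u hu => ?_
    rw [uIcc_of_le hv] at hu
    exact ((hD j).renLetter_eq hε hu).symm
  · filter_upwards [self_mem_nhdsWithin, nhdsWithin_le_nhds hball] with g hg0 hg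
    exact hfin g (by simpa using hg) hg0

theorem hasDerivWithinAt_integral_Ici {h : ℝ → ℂ} (hh : ContinuousOn h (Ici 0)) {v : ℝ}
    (hv : 0 ≤ v) : HasDerivWithinAt (fun v => ∫ u in (0 : ℝ)..v, h u) (h v) (Ici 0) v := by
  -- Extending `h` by `h 0` to the left makes the two-sided fundamental theorem available at `v =
  -- 0`.
  have hc : Continuous fun u => h (max 0 u) :=
    hh.comp_continuous (by fun_prop) fun u => le_max_left 0 u
  have h1 := (hc.integral_hasStrictDerivAt 0 v).hasDerivAt.hasDerivWithinAt (s := Ici 0)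
  rw [max_eq_right hv] at h1
  have h2 : ∀ w ∈ Ici (0 : ℝ), ∫ u in (0 : ℝ)..w, h u = ∫ u in (0 : ℝ)..w, h (max 0 u) := by
    intro w hw
    refine intervalIntegral.integral_congr fun u hu => ?_
    rw [uIcc_of_le hw] at hu
    simp only [max_eq_right hu.1]
  exact h1.congr h2 (h2 v hv)

theorem hasDerivWithinAt_renLetter {l : List (ℕ × ℕ)} (hl1 : ∀ x ∈ l, 1 ≤ x.1)
    (hl : ∀ x ∈ l, 1 ≤ x.2) {v : ℝ} (hv : 0 ≤ v) :
    HasDerivWithinAt (renLetter l)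
      (lowerSum (fun x => (x.1 : ℂ)) lowerLetter (fun l => renLetter l v) l) (Ici 0) v := by
  have h1 : ∀ w ∈ Ici (0 : ℝ), renLetter l w = lowerSum (fun x => (x.1 : ℂ)) lowerLetter
      (fun l => ∫ u in (0 : ℝ)..w, renLetter l u) l + renLetter l 0 := by
    intro w hw
    rw [← sub_eq_iff_eq_add, renLetter_sub_eq_integral hl1 hl hw]
    simp [lowerSum, letterExp]
  refine HasDerivWithinAt.congr ?_ h1 (h1 v hv)
  refine HasDerivWithinAt.add_const _ ?_
  simp only [lowerSum, smul_eq_mul]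
  exact HasDerivWithinAt.fun_sum fun j _ => (hasDerivWithinAt_integral_Ici
    (continuousOn_renLetter (one_le_snd_set_lowerLetter hl j j.2)) hv).const_mul _

end Derivative

/-! ### Functoriality of twisting. -/

section TwistedMaps

variable {Λ Λ' Λ₁ Λ₁' E E' : Type*} [AddCommGroup E] [Module ℂ E] [AddCommGroup E'] [Module ℂ E']

theorem twisted_map {op : Λ → Λ → Λ} {op' : Λ' → Λ' → Λ'} {ρ : Λ → Λ'} {op₁ : Λ₁ → Λ₁ → Λ₁}
    {op₁' : Λ₁' → Λ₁' → Λ₁'} {ρ₁ : Λ₁ → Λ₁'} {φ : Λ → Λ₁} {ψ : Λ' → Λ₁'}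
    (hφ : ∀ x y, φ (op x y) = op₁ (φ x) (φ y)) (hψ : ∀ x y, ψ (op' x y) = op₁' (ψ x) (ψ y))
    (hρ : ∀ x, ρ₁ (φ x) = ψ (ρ x)) (F : List Λ₁' → E) (l : List Λ) :
    twisted op₁ op₁' ρ₁ F (l.map φ) = twisted op op' ρ (fun l => F (l.map ψ)) l := by
  unfold twisted
  rw [contractSum_map hφ]
  congr 1
  funext l
  rw [← contractSum_map hψ, List.map_map, List.map_map]
  congr 1
  exact List.map_congr_left fun x _ => hρ x

/-- Linear relations between functionals are inherited by their twists. -/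
theorem twisted_rel {op : Λ → Λ → Λ} {op' : Λ' → Λ' → Λ'} {ρ : Λ → Λ'} {p : Λ → Prop}
    {p' : Λ' → Prop} (hp : ∀ x y, p x → p y → p (op x y))
    (hp' : ∀ x y, p' x → p' y → p' (op' x y)) (hρ : ∀ x, p x → p' (ρ x))
    (S : Submodule ℂ (E × E')) {F : List Λ' → E} {G : List Λ' → E'}
    (h : ∀ l, (∀ x ∈ l, p' x) → (F l, G l) ∈ S) {l : List Λ} (hl : ∀ x ∈ l, p x) :
    (twisted op op' ρ F l, twisted op op' ρ G l) ∈ S := by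
  have h1 := twisted_mem hp hp' hρ S (F := fun l => (F l, G l)) h hl
  have h2 := map_twisted op op' ρ (LinearMap.fst ℂ E E') (fun l => (F l, G l)) l
  have h3 := map_twisted op op' ρ (LinearMap.snd ℂ E E') (fun l => (F l, G l)) l
  simp only [LinearMap.fst_apply, LinearMap.snd_apply] at h2 h3
  rwa [← h2, ← h3]

end TwistedMaps

/-! ### From words of symbols to lists of exponents. -/

section Letters

/-- The symbol `(ξ + v) ^ (A - r g)`. -/
def letterSymb (v : ℝ) (g : ℂ) (x : ℕ × ℕ) : ℝ → ℂ :=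
  fun ξ => ((ξ + v : ℝ) : ℂ) ^ x.1 * (((ξ + v : ℝ) : ℂ) ^ (-g)) ^ x.2

/-- Words are compared as lists of functions on all of `ℝ`, so this must hold for every `ξ`. The
natural outer powers in `letterSymb` ensure it even where `ξ + v ≤ 0`. -/
theorem letterSymb_add (v : ℝ) (g : ℂ) (x y : ℕ × ℕ) :
    letterSymb v g (x + y) = letterSymb v g x * letterSymb v g y := by
  funext ξ
  simp only [letterSymb, Pi.mul_apply, Prod.fst_add, Prod.snd_add, pow_add]
  ring

/-- The symbol `(ξ + v) ^ a`. -/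
def powSymb (v : ℝ) (a : ℕ) : ℝ → ℂ := fun ξ => ((ξ + v : ℝ) : ℂ) ^ a

theorem powSymb_add (v : ℝ) (a b : ℕ) : powSymb v (a + b) = powSymb v a * powSymb v b := by
  funext ξ
  exact pow_add _ _ _

theorem symb_neg_natCast (v : ℝ) (a : ℕ) : symb v (-(a : ℂ)) = powSymb v a := by
  funext ξ
  rw [symb, powSymb, neg_neg, Complex.cpow_natCast]

theorem regularise_powSymb (γ : ℂ → ℂ) (v : ℝ) (z : ℂ) (a : ℕ) :
    regularise γ v z (powSymb v a) = letterSymb v (γ z) (a, 1) := by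
  funext ξ
  simp only [regularise, powSymb, letterSymb, pow_one]

theorem letterSymb_natCast {v : ℝ} (hv : 0 ≤ v) (g : ℂ) (x : ℕ × ℕ) {n : ℕ} (hn : 1 ≤ n) :
    letterSymb v g x n = letterVal x n (g, v) := by
  have hn' : (0 : ℝ) < n := by exact_mod_cast hn
  have h : (0 : ℝ) < n + v := by positivity
  have h' : (((n : ℝ) + v : ℝ) : ℂ) ≠ 0 := by exact_mod_cast h.ne'
  rw [letterSymb, letterVal, ← Complex.cpow_natCast, ← Complex.cpow_nat_mul,
    ← Complex.cpow_add _ _ h', Complex.cpow_def_of_ne_zero h', ← Complex.ofReal_log h.le]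
  congr 1
  ring

theorem nestedSum_map_letterSymb {v : ℝ} (hv : 0 ≤ v) (g : ℂ) (l : List (ℕ × ℕ)) : ∀ M : ℕ,
    nestedSum (l.map (letterSymb v g)) M = letterSum l M (g, v) := by
  induction l with
  | nil => intro M; rfl
  | cons x l ih =>
    intro M
    rw [List.map_cons, nestedSum, letterSum]
    refine Finset.sum_congr rfl fun n hn => ?_
    rw [ih, letterSymb_natCast hv g x (Finset.mem_Ico.1 hn).1]

theorem cutoffSum_map_letterSymb {v : ℝ} (hv : 0 ≤ v) (g : ℂ) (l : List (ℕ × ℕ)) :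
    cutoffSum (l.map (letterSymb v g)) = letterCutoff l g v := by
  simp only [cutoffSum, letterCutoff, nestedSum_map_letterSymb hv]

theorem eventually_exists_isCutoffSum {v : ℝ} (hv : 0 ≤ v) {l : List (ℕ × ℕ)}
    (hl : ∀ x ∈ l, 1 ≤ x.2) :
    ∀ᶠ g in 𝓝[≠] (0 : ℂ), ∃ c, IsCutoffSum (l.map (letterSymb v g)) c := by
  obtain ⟨ε, hε, hm⟩ := exists_radius (totalMult l)
  obtain ⟨C, hC⟩ := exists_isFamily v hε.le l hl hm
  filter_upwards [self_mem_nhdsWithin, nhdsWithin_le_nhds (Metric.closedBall_mem_nhds 0 hε)]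
    with g hg0 hg
  refine ⟨C (g, v), ?_⟩
  have := hC.fp_succ g (by simpa using hg) hg0 v ⟨hv, le_rfl⟩
  simpa only [IsCutoffSum, nestedSum_map_letterSymb hv] using this

theorem expCoeff_prod (l : List ℕ) :
    (l.map expCoeff).prod = (((l.map Nat.factorial).prod : ℕ) : ℂ)⁻¹ := by
  induction l with
  | nil => simp
  | cons i l ih => simp [ih, expCoeff, mul_comm]

theorem logCoeff_prod (l : List ℕ) (hl : ∀ i ∈ l, 0 < i) :
    (l.map logCoeff).prod = (-1 : ℂ) ^ (l.sum - l.length) * ((l.prod : ℕ) : ℂ)⁻¹ := by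
  induction l with
  | nil => simp
  | cons i l ih =>
    rw [List.forall_mem_cons] at hl
    have h1 : l.length ≤ l.sum := List.length_le_sum_of_one_le _ fun i hi => hl.2 i hi
    have h2 : (i :: l).sum - (i :: l).length = (i - 1) + (l.sum - l.length) := by
      have := hl.1
      simp only [List.sum_cons, List.length_cons]
      omega
    rw [h2, List.map_cons, List.prod_cons, ih hl.2, logCoeff, pow_add, List.prod_cons,
      Nat.cast_mul, mul_inv]
    ring

theorem hoffmanExp_single (w : Word) : hoffmanExp (Finsupp.single w 1) =
    contractSum (· * ·) expCoeff (fun u => Finsupp.single u 1) w := by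
  rw [hoffmanExp, Finsupp.linearCombination_single, one_smul, ← sum_composition_eq_contractSum]
  refine Finset.sum_congr rfl fun I _ => ?_
  rw [expCoeff_prod, Finsupp.smul_single, smul_eq_mul, mul_one]
  rfl

theorem hoffmanLog_single (w : Word) : hoffmanLog (Finsupp.single w 1) =
    contractSum (· * ·) logCoeff (fun u => Finsupp.single u 1) w := by
  rw [hoffmanLog, Finsupp.linearCombination_single, one_smul, ← sum_composition_eq_contractSum]
  refine Finset.sum_congr rfl fun I _ => ?_
  rw [logCoeff_prod _ fun i hi => I.blocks_pos hi, Finsupp.smul_single, smul_eq_mul, mul_one,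
    I.blocks_sum]
  rfl

theorem regStuffle_single (γ : ℂ → ℂ) (v : ℝ) (z : ℂ) (w : Word) :
    regStuffle γ v z (Finsupp.single w 1) =
      twisted (· * ·) (· * ·) (regularise γ v z) (fun u => Finsupp.single u 1) w := by
  rw [regStuffle, LinearMap.comp_apply, LinearMap.comp_apply, hoffmanLog_single, map_contractSum,
    map_contractSum, twisted]
  congr 1
  funext u
  rw [regTensor, Finsupp.linearCombination_single, one_smul, hoffmanExp_single]

/-- Pointwise products become sums of exponents, and regularisation becomes `a ↦ (a, 1)`; from here
on the combinatorics takes place in `ℕ` and `ℕ × ℕ`, with `z` entering only through `γ z`. -/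
theorem regStuffle_map_powSymb (γ : ℂ → ℂ) (v : ℝ) (z : ℂ) (a : List ℕ) :
    regStuffle γ v z (Finsupp.single (a.map (powSymb v)) 1) =
      twisted (· + ·) (· + ·) (fun a => (a, 1))
        (fun l => Finsupp.single (l.map (letterSymb v (γ z))) 1) a := by
  rw [regStuffle_single, twisted_map (op := (· + ·)) (op' := (· + ·)) (ρ := fun a => (a, 1))
    (ψ := letterSymb v (γ z)) (powSymb_add v) (letterSymb_add v (γ z))
    (regularise_powSymb γ v z)]

theorem regSum_map_powSymb (γ : ℂ → ℂ) {v : ℝ} (hv : 0 ≤ v) (z : ℂ) (a : List ℕ) :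
    regSum γ v (a.map (powSymb v)) z =
      twisted (· + ·) (· + ·) (fun a => (a, 1)) (fun l => letterCutoff l (γ z) v) a := by
  rw [regSum, regStuffle_map_powSymb, map_twisted]
  simp only [cutoffSumLin, Finsupp.linearCombination_single, one_smul,
    cutoffSum_map_letterSymb hv]

theorem add_one_le_snd (x y : ℕ × ℕ) (hx : 1 ≤ x.2) (_ : 1 ≤ y.2) : 1 ≤ (x + y).2 := by
  rw [Prod.snd_add]
  omega

/-- The value at `z = 0` of the regularised nested sum. -/
def renValue (a : List ℕ) (v : ℝ) : ℂ :=
  twisted (· + ·) (· + ·) (fun a => (a, 1)) (fun l => renLetter l v) a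

/-- Functions with an analytic extension to `0`, together with the value of the extension. -/
def analyticExt : Submodule ℂ ((ℂ → ℂ) × ℂ) where
  carrier := {f | ∃ H : ℂ → ℂ, AnalyticAt ℂ H 0 ∧ H 0 = f.2 ∧ ∀ᶠ g in 𝓝[≠] (0 : ℂ), f.1 g = H g}
  add_mem' := by
    rintro f f' ⟨H, h1, h2, h3⟩ ⟨H', h1', h2', h3'⟩
    refine ⟨H + H', h1.add h1', by simp [h2, h2'], ?_⟩
    filter_upwards [h3, h3'] with g h h'
    simp [h, h']
  zero_mem' := ⟨0, analyticAt_const, rfl, Eventually.of_forall fun _ => rfl⟩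
  smul_mem' := by
    rintro a f ⟨H, h1, h2, h3⟩
    refine ⟨fun g => a * H g, analyticAt_const.mul h1, by simp [h2], ?_⟩
    filter_upwards [h3] with g h
    simp [h]

/-- Analytic extension together with the value at `0` is a linear condition, so it passes to the
finite combinations formed by `twisted`. -/
theorem exists_analyticAt_twisted (a : List ℕ) {v : ℝ} (hv : 0 ≤ v) :
    ∃ H : ℂ → ℂ, AnalyticAt ℂ H 0 ∧ H 0 = renValue a v ∧ ∀ᶠ g in 𝓝[≠] (0 : ℂ),
      twisted (· + ·) (· + ·) (fun a => (a, 1)) (fun l => letterCutoff l g v) a = H g := by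
  have h := twisted_rel (op := (· + ·)) (op' := (· + ·)) (ρ := fun a : ℕ => (a, 1))
    (p := fun _ => True) (p' := fun x : ℕ × ℕ => 1 ≤ x.2) (fun _ _ _ _ => trivial)
    add_one_le_snd (fun _ _ => le_rfl) analyticExt (F := fun l g => letterCutoff l g v)
    (G := fun l => renLetter l v) (fun l hl => exists_analyticAt_letterCutoff hl hv)
    (l := a) (fun _ _ => trivial)
  obtain ⟨H, h1, h2, h3⟩ := h
  refine ⟨H, h1, h2, ?_⟩
  filter_upwards [h3] with g hg
  rw [← hg]
  exact (map_twisted (· + ·) (· + ·) (fun a : ℕ => (a, 1))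
    (LinearMap.proj (R := ℂ) (φ := fun _ : ℂ => ℂ) g)
    (fun (l : List (ℕ × ℕ)) (g : ℂ) => letterCutoff l g v) a).symm

variable {γ : ℂ → ℂ}

/-- Since `γ' (0) ≠ 0`, `γ` avoids `0` on a punctured neighbourhood, so statements for small `g ≠ 0`
apply to `g = γ z`. -/
theorem tendsto_punctured (hγ : AnalyticAt ℂ γ 0) (hγ0 : γ 0 = 0) (hγ1 : deriv γ 0 = 1) :
    Tendsto γ (𝓝[≠] 0) (𝓝[≠] 0) := by
  refine tendsto_nhdsWithin_iff.2 ⟨?_, ?_⟩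
  · have := hγ.continuousAt.tendsto
    rw [hγ0] at this
    exact this.mono_left nhdsWithin_le_nhds
  · have h := hγ.differentiableAt.hasDerivAt
    rw [hγ1] at h
    exact h.eventually_ne one_ne_zero

theorem exists_analyticAt_regSum (hγ : AnalyticAt ℂ γ 0) (hγ0 : γ 0 = 0) (hγ1 : deriv γ 0 = 1)
    (a : List ℕ) {v : ℝ} (hv : 0 ≤ v) : ∃ H : ℂ → ℂ, AnalyticAt ℂ H 0 ∧ H 0 = renValue a v ∧
      ∀ᶠ z in 𝓝[≠] (0 : ℂ), regSum γ v (a.map (powSymb v)) z = H z := by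
  obtain ⟨H, h1, h2, h3⟩ := exists_analyticAt_twisted a hv
  refine ⟨H ∘ γ, AnalyticAt.comp (by rwa [hγ0]) hγ, by simp [hγ0, h2], ?_⟩
  filter_upwards [(tendsto_punctured hγ hγ0 hγ1).eventually h3] with z hz
  rw [regSum_map_powSymb γ hv, hz]
  rfl

/-- Families of tensors whose words eventually have a cut-off nested sum. -/
def eventuallySummable : Submodule ℂ (ℂ → Tens) where
  carrier := {f | ∀ᶠ g in 𝓝[≠] (0 : ℂ), f g ∈ Finsupp.supported ℂ ℂ {u | ∃ c, IsCutoffSum u c}}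
  add_mem' := by
    intro f f' h h'
    rw [mem_ofPred_eq] at *
    filter_upwards [h, h'] with g hg hg'
    exact Submodule.add_mem _ hg hg'
  zero_mem' := by
    rw [mem_ofPred_eq]
    exact Eventually.of_forall fun _ => Submodule.zero_mem _
  smul_mem' := by
    intro a f h
    rw [mem_ofPred_eq] at *
    filter_upwards [h] with g hg
    exact Submodule.smul_mem _ a hg

theorem isRenormalisable_map_powSymb (hγ : AnalyticAt ℂ γ 0) (hγ0 : γ 0 = 0)
    (hγ1 : deriv γ 0 = 1) (a : List ℕ) {v : ℝ} (hv : 0 ≤ v) :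
    IsRenormalisable γ v (a.map (powSymb v)) := by
  constructor
  · have h := twisted_mem (op := (· + ·)) (op' := (· + ·)) (ρ := fun a : ℕ => (a, 1))
      (p := fun _ => True) (p' := fun x : ℕ × ℕ => 1 ≤ x.2) (fun _ _ _ _ => trivial)
      add_one_le_snd (fun _ _ => le_rfl) eventuallySummable
      (F := fun l g => Finsupp.single (l.map (letterSymb v g)) 1) (fun l hl => by
        filter_upwards [eventually_exists_isCutoffSum hv hl] with g hg
        exact Finsupp.single_mem_supported ℂ _ hg)
      (l := a) (fun _ _ => trivial)
    filter_upwards [(tendsto_punctured hγ hγ0 hγ1).eventually h] with z hz u hu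
    rw [regStuffle_map_powSymb] at hu
    have h2 := map_twisted (· + ·) (· + ·) (fun a : ℕ => (a, 1))
      (LinearMap.proj (R := ℂ) (φ := fun _ : ℂ => Tens) (γ z))
      (fun l g => Finsupp.single (l.map (letterSymb v g)) 1) a
    simp only [LinearMap.proj_apply] at h2
    rw [← h2] at hu
    exact (Finsupp.mem_supported ℂ _).1 hz hu
  · obtain ⟨H, h1, -, h3⟩ := exists_analyticAt_regSum hγ hγ0 hγ1 a hv
    refine h1.meromorphicAt.congr ?_
    filter_upwards [h3] with z hz
    exact hz.symm

end Letters

/-! ### Triviality of the Birkhoff decomposition. -/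

section Birkhoff

/-- The pole part is a chosen polynomial `p`. As `p (1 / z)` has a finite limit at `0`, `p` is
constant, and it has no constant term. -/
theorem polePart_eq_zero {f H : ℂ → ℂ} (hH : AnalyticAt ℂ H 0)
    (h : ∀ᶠ z in 𝓝[≠] (0 : ℂ), f z = H z) : polePart f = 0 := by
  have hex : ∃ p, IsPolePart f p := ⟨0, by simp, H, hH, by simpa using h⟩
  rw [polePart, dif_pos hex]
  obtain ⟨h0, g, hg, hfg⟩ := hex.choose_spec
  set p := hex.choose
  have hlim : Tendsto (fun z : ℂ => p.eval z⁻¹) (𝓝[≠] 0) (𝓝 (H 0 - g 0)) := by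
    refine Tendsto.congr' ?_
      ((hH.continuousAt.tendsto.sub hg.continuousAt.tendsto).mono_left nhdsWithin_le_nhds)
    filter_upwards [h, hfg] with z h1 h2
    rw [← h1, h2, add_sub_cancel_right]
  by_contra hp
  by_cases hd : 0 < p.degree
  · have h1 := p.tendsto_norm_atTop hd (l := 𝓝[≠] (0 : ℂ)) (z := fun z => z⁻¹)
      (tendsto_norm_inv_nhdsNE_zero_atTop)
    exact not_tendsto_nhds_of_tendsto_atTop h1 _ hlim.norm
  · have h1 := Polynomial.eq_C_of_degree_le_zero (not_lt.1 hd)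
    rw [h0, Polynomial.C_0] at h1
    exact hp h1

variable {Φ : Word → ℂ → ℂ} {P : Word → Prop}

/-- Strong induction on length: the counterterms of proper nonempty prefixes vanish, so the prepared
function is `Φ w` itself, which has no pole. -/
theorem birkhoffMinus_eq_zero (hP : ∀ w n, P w → P (w.take n))
    (hΦ : ∀ w, P w → ∃ H : ℂ → ℂ, AnalyticAt ℂ H 0 ∧ ∀ᶠ z in 𝓝[≠] (0 : ℂ), Φ w z = H z)
    (n : ℕ) : ∀ w : Word, w.length = n → P w → w ≠ [] → birkhoffMinus Φ w = 0 := by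
  induction n using Nat.strong_induction_on with
  | _ n ih =>
    intro w hn hw hne
    obtain ⟨H, h1, h2⟩ := hΦ w hw
    rw [birkhoffMinus, if_neg hne, polePart_eq_zero h1, neg_zero]
    filter_upwards [h2] with z hz
    rw [hz, add_eq_left]
    refine Finset.sum_eq_zero fun j _ => ?_
    have hj := j.2
    have hl : (w.take (j + 1)).length = j + 1 := by
      rw [List.length_take]
      omega
    rw [ih (j + 1) (by omega) _ hl (hP _ _ hw), Polynomial.eval_zero, zero_mul]
    intro h
    rw [h] at hl
    simp at hl

/-- If `Φ` is holomorphic on all words of a class, the Birkhoff decomposition is trivial. -/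
theorem birkhoffPlus_eq (hP : ∀ w n, P w → P (w.take n))
    (hΦ : ∀ w, P w → ∃ H : ℂ → ℂ, AnalyticAt ℂ H 0 ∧ ∀ᶠ z in 𝓝[≠] (0 : ℂ), Φ w z = H z)
    {w : Word} (hw : P w) : birkhoffPlus Φ w = Φ w := by
  have h : birkhoffPrepared Φ w = Φ w := by
    funext z
    rw [birkhoffPrepared, add_eq_left]
    refine Finset.sum_eq_zero fun j _ => ?_
    have hj := j.2
    rw [birkhoffMinus_eq_zero hP hΦ _ _ rfl (hP _ _ hw), Polynomial.eval_zero, zero_mul]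
    intro h
    have := congrArg List.length h
    rw [List.length_take, List.length_nil] at this
    omega
  funext z
  obtain ⟨H, h1, h2⟩ := hΦ w hw
  rw [birkhoffPlus, h, polePart_eq_zero h1 h2, Polynomial.eval_zero, sub_zero]

theorem renSum_map_powSymb {γ : ℂ → ℂ} (hγ : AnalyticAt ℂ γ 0) (hγ0 : γ 0 = 0)
    (hγ1 : deriv γ 0 = 1) (a : List ℕ) {v : ℝ} (hv : 0 ≤ v) :
    renSum γ v (a.map (powSymb v)) = renValue a v := by
  rw [renSum, birkhoffPlus_eq (P := fun w => ∃ a : List ℕ, w = a.map (powSymb v)) ?_ ?_ ⟨a, rfl⟩]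
  · obtain ⟨H, h1, h2, h3⟩ := exists_analyticAt_regSum hγ hγ0 hγ1 a hv
    refine Tendsto.limUnder_eq (Tendsto.congr' ?_
      (h2 ▸ h1.continuousAt.tendsto.mono_left nhdsWithin_le_nhds))
    filter_upwards [h3] with z hz
    exact hz.symm
  · rintro _ n ⟨a, rfl⟩
    exact ⟨a.take n, by rw [List.map_take]⟩
  · rintro _ ⟨a, rfl⟩
    obtain ⟨H, h1, -, h3⟩ := exists_analyticAt_regSum hγ hγ0 hγ1 a hv
    exact ⟨H, h1, h3⟩

theorem symbWord_neg_natCast {k : ℕ} (a : Fin k → ℕ) (v : ℝ) :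
    symbWord (fun i => -(a i : ℂ)) v = (List.ofFn a).map (powSymb v) := by
  rw [symbWord, List.map_ofFn]
  congr 1
  funext i
  exact symb_neg_natCast v (a i)

theorem zeta_neg_natCast {γ : ℂ → ℂ} (hγ : AnalyticAt ℂ γ 0) (hγ0 : γ 0 = 0)
    (hγ1 : deriv γ 0 = 1) {k : ℕ} (a : Fin k → ℕ) {v : ℝ} (hv : 0 ≤ v) :
    zeta γ (fun i => -(a i : ℂ)) v = renValue (List.ofFn a) v := by
  rw [zeta, symbWord_neg_natCast, renSum_map_powSymb hγ hγ0 hγ1 _ hv]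

end Birkhoff

/-! ### The shift and derivative identities for renormalised values. -/

section Values

theorem renValue_shift (a : List ℕ) (b : ℕ) {v : ℝ} (hv : 0 ≤ v) :
    renValue (a ++ [b]) v =
      renValue (a ++ [b]) (v + 1) + ((v : ℂ) + 1) ^ b * renValue a (v + 1) := by
  have h := twisted_rel (op := (· + ·)) (op' := (· + ·)) (ρ := fun a : ℕ => (a, 1))
    (p := fun _ => True) (p' := fun x : ℕ × ℕ => 1 ≤ x.2) (fun _ _ _ _ => trivial)
    add_one_le_snd (fun _ _ => le_rfl)
    (LinearMap.eqLocus (LinearMap.fst ℂ ℂ ℂ) (LinearMap.snd ℂ ℂ ℂ))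
    (F := fun l => renLetter l v) (fun l hl => renLetter_shift hv hl)
    (l := a ++ [b]) (fun _ _ => trivial)
  refine Eq.trans h ?_
  exact twisted_append (op := (· + ·)) (op' := (· + ·)) (ρ := fun a : ℕ => (a, 1))
    (χ := fun x : ℕ × ℕ => ((v : ℂ) + 1) ^ x.1) (fun x y => pow_add _ _ _)
    (fun x y => pow_add _ _ _) (fun l => renLetter l (v + 1)) a b

/-- Functions on `[0, ∞)` with a given derivative at `v`. -/
def derivRel (v : ℝ) : Submodule ℂ ((ℝ → ℂ) × ℂ) where
  carrier := {f | HasDerivWithinAt f.1 f.2 (Ici 0) v}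
  add_mem' := fun h h' => HasDerivWithinAt.add h h'
  zero_mem' := hasDerivWithinAt_const v _ (0 : ℂ)
  smul_mem' := fun a _ h => HasDerivWithinAt.const_smul a h

/-- Merging adds exponents, so every contracted letter still has exponent at least `1` and
`hasDerivWithinAt_renLetter` applies to each term. Having a given derivative at `v` is a linear
relation, hence survives twisting. -/
theorem hasDerivWithinAt_renValue {a : List ℕ} (ha : ∀ x ∈ a, 1 ≤ x) {v : ℝ} (hv : 0 ≤ v) :
    HasDerivWithinAt (renValue a)
      (lowerSum (fun x : ℕ => (x : ℂ)) (fun x => x - 1) (fun a => renValue a v) a) (Ici 0) v := by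
  have h := twisted_rel (op := (· + ·)) (op' := (· + ·)) (ρ := fun a : ℕ => (a, 1))
    (p := fun x => 1 ≤ x) (p' := fun x : ℕ × ℕ => 1 ≤ x.1 ∧ 1 ≤ x.2)
    (fun _ _ h _ => le_add_right h)
    (fun x y hx hy => ⟨le_add_right hx.1, add_one_le_snd x y hx.2 hy.2⟩) (fun _ h => ⟨h, le_rfl⟩)
    (derivRel v) (F := renLetter)
    (fun l hl => hasDerivWithinAt_renLetter (fun x hx => (hl x hx).1) (fun x hx => (hl x hx).2) hv)
    (l := a) ha
  have h1 : twisted (· + ·) (· + ·) (fun a : ℕ => (a, 1)) renLetter a = renValue a := by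
    funext u
    exact map_twisted _ _ _ (LinearMap.proj (R := ℂ) (φ := fun _ : ℝ => ℂ) u) _ a
  have h2 : lowerSum (fun x : ℕ => (x : ℂ)) (fun x => x - 1) (fun a => renValue a v) a =
      twisted (· + ·) (· + ·) (fun a : ℕ => (a, 1))
        (lowerSum (fun x : ℕ × ℕ => (x.1 : ℂ)) lowerLetter (fun l => renLetter l v)) a := by
    refine lowerSum_twisted (op := (· + ·)) (op' := (· + ·)) (ρ := fun a : ℕ => (a, 1))
      (wt := fun x : ℕ => (x : ℂ)) (dn := fun x => x - 1) (wt' := fun x : ℕ × ℕ => (x.1 : ℂ))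
      (dn' := lowerLetter) (fun x y => Nat.cast_add x y) ?_ ?_
      (fun x y => Nat.cast_add x.1 y.1) ?_ ?_ (fun _ => rfl) (fun _ => rfl) _ a
    · intro x y hx
      have : x ≠ 0 := by exact_mod_cast hx
      omega
    · intro x y hy
      have : y ≠ 0 := by exact_mod_cast hy
      omega
    · intro x y hx
      have : x.1 ≠ 0 := by exact_mod_cast hx
      ext
      · simp only [lowerLetter, Prod.fst_add]
        omega
      · rfl
    · intro x y hy
      have : y.1 ≠ 0 := by exact_mod_cast hy
      ext
      · simp only [lowerLetter, Prod.fst_add]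
        omega
      · rfl
  rw [h2, ← h1]
  exact h

theorem lowerSum_ofFn {E : Type*} [AddCommGroup E] [Module ℂ E] (F : List ℕ → E) {k : ℕ}
    (a : Fin k → ℕ) :
    lowerSum (fun x : ℕ => (x : ℂ)) (fun x => x - 1) F (List.ofFn a) =
      ∑ j, (a j : ℂ) • F (List.ofFn (Function.update a j (a j - 1))) := by
  rw [lowerSum]
  refine Fintype.sum_equiv (finCongr List.length_ofFn) _ _ fun j => ?_
  have h1 : (List.ofFn a)[j] = a (finCongr List.length_ofFn j) := by
    simp only [Fin.getElem_fin, List.getElem_ofFn]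
    rfl
  rw [h1]
  congr 2
  refine List.ext_getElem (by simp) fun i h h' => ?_
  simp only [List.getElem_set, List.getElem_ofFn, Function.update_apply, Fin.ext_iff,
    finCongr_apply, Fin.val_cast]
  by_cases hij : (j : ℕ) = i
  · simp [hij]
  · simp [hij, Ne.symm hij]

end Values

end RenZeta

end

theorem mainTheorem8 (γ : ℂ → ℂ) (hγ : AnalyticAt ℂ γ 0) (hγ0 : γ 0 = 0)
    (hγ1 : deriv γ 0 = 1) :
    -- all the values involved are well defined
    (∀ (k : ℕ) (a : Fin k → ℕ) (v : ℝ), 0 ≤ v →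
      RenZeta.IsRenormalisable γ v (RenZeta.symbWord (fun i => -(a i : ℂ)) v)) ∧
    -- the shift identity, in depth `k + 1`
    (∀ (k : ℕ) (a : Fin (k + 1) → ℕ) (v : ℝ), 0 ≤ v →
      RenZeta.zeta γ (fun i => -(a i : ℂ)) (v + 1) =
        RenZeta.zeta γ (fun i => -(a i : ℂ)) v -
          ((v : ℂ) + 1) ^ a (Fin.last k) *
            RenZeta.zeta γ (fun i : Fin k => -(a i.castSucc : ℂ)) (v + 1)) ∧
    -- the derivative identity (one-sided at `v = 0`)
    (∀ (k : ℕ) (a : Fin k → ℕ), (∀ i, 1 ≤ a i) → ∀ v : ℝ, 0 ≤ v →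
      HasDerivWithinAt (fun w : ℝ => RenZeta.zeta γ (fun i => -(a i : ℂ)) w)
        (∑ j, (a j : ℂ) *
          RenZeta.zeta γ (Function.update (fun i => -(a i : ℂ)) j (-(a j : ℂ) + 1)) v)
        (Set.Ici 0) v) := by
  refine ⟨fun k a v hv => ?_, fun k a v hv => ?_, fun k a ha v hv => ?_⟩
  · rw [RenZeta.symbWord_neg_natCast]
    exact RenZeta.isRenormalisable_map_powSymb hγ hγ0 hγ1 _ hv
  · have hv' : 0 ≤ v + 1 := by linarith
    rw [RenZeta.zeta_neg_natCast hγ hγ0 hγ1 a hv, RenZeta.zeta_neg_natCast hγ hγ0 hγ1 a hv',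
      RenZeta.zeta_neg_natCast hγ hγ0 hγ1 (fun i : Fin k => a i.castSucc) hv',
      List.ofFn_succ_last, RenZeta.renValue_shift _ _ hv, add_sub_cancel_right]
  -- Because `1 ≤ a j`, the truncated `a j - 1` is a true difference and the lowered arguments are
  -- again negatives of natural numbers.
  · have hupd : ∀ j, Function.update (fun i => -(a i : ℂ)) j (-(a j : ℂ) + 1) =
        fun i => -((Function.update a j (a j - 1) i : ℕ) : ℂ) := by
      intro j
      funext i
      by_cases hij : i = j
      · subst hij
        simp only [Function.update_self]
        rw [Nat.cast_sub (ha i)]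
        push_cast
        ring
      · simp only [Function.update_of_ne hij]
    have h := RenZeta.hasDerivWithinAt_renValue (a := List.ofFn a)
      (by simpa [List.forall_mem_ofFn_iff] using ha) hv
    rw [RenZeta.lowerSum_ofFn] at h
    simp only [smul_eq_mul] at h
    simp only [hupd, fun j => RenZeta.zeta_neg_natCast hγ hγ0 hγ1 (Function.update a j (a j - 1)) hv]
    exact h.congr (fun w hw => RenZeta.zeta_neg_natCast hγ hγ0 hγ1 a hw)
      (RenZeta.zeta_neg_natCast hγ hγ0 hγ1 a hv)
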